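/- For distributions $q_1,q_2$ on $[n]=\{1,\dots,n\}$ and $\alpha\in[0,1]$ let $q_\alpha=(1-\alpha)q_1+\alpha q_2$, and let $\Pi_{q_1,q_2}=\{q_\alpha : \alpha\in[0,1]\}$ be the set of mixtures of $q_1$ and $q_2$. For $\epsilon>0$, an *identity tester in the presence of known noise* for $(q_1,q_2,\epsilon)$ is a (possibly randomized) algorithm that knows $n,\epsilon,q_1,q_2$, draws independent samples from an unknown distribution $p$ on $[n]$, and, for every $p$, accepts with probability at least $2/3$ if $p\in\Pi_{q_1,q_2}$, and rejects with probability at least $2/3$ if $\|p-q\|_1\ge\epsilon$ for all $q\in\Pi_{q_1,q_2}$. Consider the following algorithm, with $m$ and $s$ samples in its two phases. 1. *Learn.* Let $\epsilon'=\epsilon/6$. If $\|q_1-q_2\|_1<\epsilon'$, set $\alpha=0$. Otherwise let $S=\{i : q_1(i)>q_2(i)\}$, let $w_S$ be the fraction of $m$ samples from $p$ that lie in $S$, and let $\alpha$ be the number $\frac{q_1(S)-(w_S+\epsilon'/4)}{q_1(S)-q_2(S)}$, truncated to $[0,1]$. 2. *Reshape.* Let $a_i=\lfloor n q_\alpha(i)\rfloor+\left\lfloor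 \frac{n|q_\alpha(i)-q_2(i)|}{\|q_\alpha-q_2\|_1}\right\rfloor+1$ (the middle term being $0$ if $q_\alpha=q_2$), $D=\{(i,j): i\in[n],\ j\in[a_i]\}$ and $q'_\alpha(i,j)=q_\alpha(i)/a_i$. Draw $s$ further samples from $p$, and replace each such sample $i$ by $(i,r)$ with $r$ uniform in $[a_i]$, independently. 3. *Test.* With $Y_d$ the number of occurrences of $d\in D$ among these $s$ pairs, accept if and only if $$\sum_{d\in D}\left(\frac{Y_d(Y_d-1)}{s(s-1)}-\frac{2\,q'_\alpha(d)\,Y_d}{s}+q'_\alpha(d)^2\right)\le\frac{\epsilon^2}{2|D|}$$ (the left side estimates the squared $\ell_2$-distance of the sampled distribution to $q'_\alpha$; fractions with denominator $0$ are read as $0$, here and in step 1). **Upper bound.** There are absolute constants $C_1,C_2,C>0$ such that for all $n$, all $\epsilon>0$ and all distributions $q_1,q_2$ on $[n]$, this algorithm with $m=\lfloor C_1/\epsilon^2\rfloor$ and $s=\lfloor C_2\sqrt n/\epsilon^2\rfloor$ is an identity tester in the presence of known noise for $(q_1,q_2,\epsilon)$, and it uses $m+s\le C\sqrt n/\epsilon^2$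 samples. **Lower bound.** There is an absolute constant $c>0$ such that for all $n\ge2$ and all $0<\epsilon\le1$, every identity tester in the presence of known noise for $q_1=q_2=$ the uniform distribution on $[n]$ and proximity parameter $\epsilon$ uses at least $c\sqrt n/\epsilon^2$ samples. -/

import Mathlib

namespace MixtureTesting

/-! Distributions on `[n]` are the elements of `stdSimplex ℝ (Fin n)`. -/

/-- The `ℓ₁`-distance of two vectors. -/
def l1Dist {D : Type*} [Fintype D] (p q : D → ℝ) : ℝ := ∑ i, |p i - q i|

/-- The vector `(1 - α) q₁ + α q₂`. -/
def mixture {n : ℕ} (q₁ q₂ : Fin n → ℝ) (α : ℝ) : Fin n → ℝ :=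
  fun i => (1 - α) * q₁ i + α * q₂ i

/-- The set of all mixtures of `q₁` and `q₂`. -/
def mixtures {n : ℕ} (q₁ q₂ : Fin n → ℝ) : Set (Fin n → ℝ) :=
  {p | ∃ α ∈ Set.Icc (0 : ℝ) 1, p = mixture q₁ q₂ α}

/-- The uniform distribution on `[n]`. -/
noncomputable def uniform (n : ℕ) : Fin n → ℝ := fun _ => 1 / (n : ℝ)

/-- A randomized algorithm that draws `m` samples from a distribution on `[n]` and then accepts
(`true`) or rejects (`false`). -/
abbrev SampleAlgorithm (n m : ℕ) : Type := (Fin m → Fin n) → PMF Bool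

/-- The probability that `A` outputs `b` when its `m` samples are drawn independently from `p`
(over the samples and the internal randomness of `A`). -/
noncomputable def outputProb {n m : ℕ} (p : Fin n → ℝ) (A : SampleAlgorithm n m) (b : Bool) : ℝ :=
  ∑ x : Fin m → Fin n, (∏ j, p (x j)) * (A x b).toReal

/-- `A` is an identity tester in the presence of known noise, for the known distributions `q₁`
and `q₂` and the proximity parameter `ε`. -/
def IsMixtureTester {n m : ℕ} (q₁ q₂ : Fin n → ℝ) (ε : ℝ) (A : SampleAlgorithm n m) : Prop :=
  ∀ p ∈ stdSimplex ℝ (Fin n),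
    (p ∈ mixtures q₁ q₂ → 2 / 3 ≤ outputProb p A true) ∧
    ((∀ q ∈ mixtures q₁ q₂, ε ≤ l1Dist p q) → 2 / 3 ≤ outputProb p A false)

/-! ### The learner -/

/-- The elements that are more likely under `q₁` than under `q₂`. -/
noncomputable def heavySet {n : ℕ} (q₁ q₂ : Fin n → ℝ) : Finset (Fin n) :=
  Finset.univ.filter fun i => q₂ i < q₁ i

/-- The fraction of the samples `x` that lie in `S`. -/
noncomputable def empiricalWeight {n m : ℕ} (S : Finset (Fin n)) (x : Fin m → Fin n) : ℝ :=
  ((Finset.univ.filter fun j => x j ∈ S).card : ℝ) / (m : ℝ)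

/-- The learner: it outputs a mixture parameter, computed from the samples `x`. The estimate is
truncated to `[0, 1]`, so that it always is a mixture parameter. -/
noncomputable def mixtureLearner {n m : ℕ} (q₁ q₂ : Fin n → ℝ) (ε : ℝ) (x : Fin m → Fin n) : ℝ :=
  if l1Dist q₁ q₂ < ε then 0
  else
    let S := heavySet q₁ q₂
    max 0 (min 1
      (((∑ i ∈ S, q₁ i) - (empiricalWeight S x + ε / 4)) / ((∑ i ∈ S, q₁ i) - ∑ i ∈ S, q₂ i)))

/-! ### Reshaping -/

/-- The number `a i` of buckets into which `i` is split, for the mixture `qα`. (If `qα = q₂`, the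
second summand is `0`.) -/
noncomputable def buckets {n : ℕ} (qα q₂ : Fin n → ℝ) (i : Fin n) : ℕ :=
  ⌊(n : ℝ) * qα i⌋₊ + ⌊(n : ℝ) * |qα i - q₂ i| / l1Dist qα q₂⌋₊ + 1

instance {n : ℕ} (qα q₂ : Fin n → ℝ) (i : Fin n) : NeZero (buckets qα q₂ i) :=
  ⟨Nat.succ_ne_zero _⟩

/-- The vector on the domain of the pairs `(i, j)`, `j ∈ [a i]`, that splits `p i` equally among
the `a i` buckets of `i`. -/
noncomputable def reshape {n : ℕ} (a : Fin n → ℕ) (p : Fin n → ℝ) : (Σ i, Fin (a i)) → ℝ :=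
  fun d => p d.1 / (a d.1 : ℝ)

/-! ### The `ℓ₂` identity tester -/

/-- The number of occurrences of `d` among the samples `y`. -/
def occurrences {D : Type*} [DecidableEq D] {s : ℕ} (y : Fin s → D) (d : D) : ℕ :=
  (Finset.univ.filter fun j => y j = d).card

/-- The unbiased estimator of `‖p - q‖₂²`, for a known `q` and `s` samples `y` from `p`. -/
noncomputable def l2Statistic {D : Type*} [Fintype D] [DecidableEq D] {s : ℕ}
    (q : D → ℝ) (y : Fin s → D) : ℝ :=
  ∑ d, ((occurrences y d : ℝ) * ((occurrences y d : ℝ) - 1) / ((s : ℝ) * ((s : ℝ) - 1))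
    - 2 * q d * (occurrences y d : ℝ) / (s : ℝ) + q d ^ 2)

/-- The `ℓ₂` identity tester: accept iff the estimate of `‖p - q‖₂²` is at most `ε² / (2 |D|)`. -/
noncomputable def identityTester {D : Type*} [Fintype D] [DecidableEq D] {s : ℕ}
    (q : D → ℝ) (ε : ℝ) (y : Fin s → D) : Bool :=
  decide (l2Statistic q y ≤ ε ^ 2 / (2 * (Fintype.card D : ℝ)))

/-! ### The mixture tester -/

/-- The tester: learn the mixture parameter with accuracy `ε / 6` from the first `m` samples,
replace each of the other `s` samples `i` by `(i, r)` with `r` uniform in `[a i]` (independently),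
and run the `ℓ₂` identity tester for the reshaped `qα` on these. -/
noncomputable def mixtureIdentityTester {n : ℕ} (q₁ q₂ : Fin n → ℝ) (ε : ℝ) (m s : ℕ) :
    SampleAlgorithm n (m + s) := fun x =>
  let α := mixtureLearner q₁ q₂ (ε / 6) fun j : Fin m => x (Fin.castAdd s j)
  let qα := mixture q₁ q₂ α
  let a := buckets qα q₂
  let x' : Fin s → Fin n := fun j => x (Fin.natAdd m j)
  (PMF.uniformOfFintype (∀ j : Fin s, Fin (a (x' j)))).map fun r =>
    identityTester (reshape a qα) ε fun j => (⟨x' j, r j⟩ : Σ i, Fin (a i))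

end MixtureTesting

/-!
Upper bound: the centred statistic of the `ℓ₂` tester is an off-diagonal sum of a degenerate kernel
plus a linear term (Hoeffding's decomposition), so its variance is controlled by `‖p‖₂²` and
`‖p - q‖₂²`. After the reshaping `q_α` is flat, hence so is every `p` that is `ℓ₂`-close to it, and
Chebyshev's inequality separates the two cases with `O(√n / ε²)` samples. The learner subtracts
`ε' / 4` in order to err on the side of `q₁`: with probability `5 / 6` the unknown `p` is a mixture
of `q_α` and `q₂` close to `q_α`, and the second summand of the bucket sizes makes the difference
`q_α - q₂` flat, so that `p` is close to `q_α` in `ℓ₂` as well.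

Lower bound: pair up the elements of `[n]` and move the weight `ε / n` inside each pair in a random
direction. By the Cauchy–Schwarz inequality the tester distinguishes these perturbations from the
uniform distribution only if the second moment of the mean likelihood ratio is bounded away from
`1`. This second moment is an average of `k`-th powers of correlations of two perturbations, at most
`exp (6 t + n t²)` for `t = k ε² / n`.
-/

namespace MixtureTesting

open scoped BigOperators

section Expectation

variable {D Z : Type*} [Fintype D] [Fintype Z] {p : D → ℝ} {s : ℕ}

/-- The expectation of `F` over `s` independent samples from `p`. It is a finite sum, in the form
of `outputProb`, so that it makes sense for weights `p` of any sign and total mass. -/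
def iidExp (p : D → ℝ) (F : (Fin s → D) → ℝ) : ℝ :=
  ∑ y : Fin s → D, (∏ j, p (y j)) * F y

/-- The probability of the event `E` for `s` independent samples from `p`. -/
noncomputable def iidProb (p : D → ℝ) (E : Set (Fin s → D)) : ℝ :=
  iidExp p (E.indicator 1)

lemma iidExp_add (F G : (Fin s → D) → ℝ) :
    iidExp p (fun y => F y + G y) = iidExp p F + iidExp p G := by
  simp only [iidExp, mul_add, Finset.sum_add_distrib]

lemma iidExp_const_mul (c : ℝ) (F : (Fin s → D) → ℝ) :
    iidExp p (fun y => c * F y) = c * iidExp p F := by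
  simp only [iidExp, Finset.mul_sum, mul_left_comm c]

lemma iidExp_sum (F : Z → (Fin s → D) → ℝ) :
    iidExp p (fun y => ∑ z, F z y) = ∑ z, iidExp p (F z) := by
  simp only [iidExp, Finset.mul_sum]
  exact Finset.sum_comm

lemma iidExp_expect (F : Z → (Fin s → D) → ℝ) :
    iidExp p (fun y => 𝔼 z, F z y) = 𝔼 z, iidExp p (F z) := by
  simp only [iidExp, Finset.mul_expect]
  exact (Finset.expect_sum_comm _ _ _).symm

lemma iidExp_mono (hp : ∀ d, 0 ≤ p d) {F G : (Fin s → D) → ℝ} (h : ∀ y, F y ≤ G y) :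
    iidExp p F ≤ iidExp p G :=
  Finset.sum_le_sum fun y _ => mul_le_mul_of_nonneg_left (h y) (Finset.prod_nonneg fun _ _ => hp _)

lemma iidExp_prod (h : D → ℝ) :
    iidExp p (fun y : Fin s → D => ∏ j, h (y j)) = (∑ d, p d * h d) ^ s := by
  simp only [iidExp, ← Finset.prod_mul_distrib, Fintype.sum_pow]

lemma iidExp_const (hp : ∑ d, p d = 1) (c : ℝ) : iidExp p (fun _ : Fin s → D => c) = c := by
  rw [iidExp, ← Finset.sum_mul, ← Fintype.sum_pow, hp, one_pow, one_mul]

lemma iidExp_mul (h : D → ℝ) (F : (Fin s → D) → ℝ) :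
    iidExp (p * h) F = iidExp p fun y => (∏ j, h (y j)) * F y := by
  simp only [iidExp, Pi.mul_apply, Finset.prod_mul_distrib, mul_assoc]

lemma iidExp_castAdd_natAdd {m : ℕ} (F : (Fin m → D) → (Fin s → D) → ℝ) :
    iidExp p (fun z => F (fun j => z (Fin.castAdd s j)) fun j => z (Fin.natAdd m j)) =
      iidExp p fun x => iidExp p (F x) := by
  simp only [iidExp, Finset.mul_sum]
  rw [← Fintype.sum_prod_type', ← (Fin.appendEquiv m s).sum_comp]
  refine Finset.sum_congr rfl fun x _ => ?_
  simp [Fin.prod_univ_add, Fin.appendEquiv, mul_assoc]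

lemma iidExp_succ (F : (Fin (s + 1) → D) → ℝ) :
    iidExp p F = ∑ a, p a * iidExp p fun y : Fin s → D => F (Matrix.vecCons a y) := by
  simp only [iidExp, Finset.mul_sum]
  rw [← Fintype.sum_prod_type', ← (Fin.consEquiv fun _ => D).sum_comp]
  refine Finset.sum_congr rfl fun x _ => ?_
  simp [Fin.prod_univ_succ, Fin.consEquiv, Matrix.vecCons, mul_assoc]

lemma sq_iidExp_mul_le (hp : ∀ d, 0 ≤ p d) (F G : (Fin s → D) → ℝ) :
    iidExp p (fun y => F y * G y) ^ 2 ≤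
      iidExp p (fun y => F y ^ 2) * iidExp p (fun y => G y ^ 2) := by
  have hw (y : Fin s → D) : 0 ≤ ∏ j, p (y j) := Finset.prod_nonneg fun _ _ => hp _
  exact Finset.sum_sq_le_sum_mul_sum_of_sq_le_mul _
    (fun y _ => mul_nonneg (hw y) (sq_nonneg _)) (fun y _ => mul_nonneg (hw y) (sq_nonneg _))
    fun y _ => (by ring : _ = _).le

lemma iidProb_nonneg (hp : ∀ d, 0 ≤ p d) (E : Set (Fin s → D)) : 0 ≤ iidProb p E :=
  Finset.sum_nonneg fun _ _ => mul_nonneg (Finset.prod_nonneg fun _ _ => hp _)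
    (Set.indicator_nonneg (fun _ _ => zero_le_one) _)

lemma iidProb_mono (hp : ∀ d, 0 ≤ p d) {E E' : Set (Fin s → D)} (h : E ⊆ E') :
    iidProb p E ≤ iidProb p E' :=
  iidExp_mono hp (Set.indicator_le_indicator_of_subset h fun _ => zero_le_one)

lemma iidProb_eq_one (hp : ∑ d, p d = 1) {E : Set (Fin s → D)} (hE : ∀ y, y ∈ E) :
    iidProb p E = 1 := by
  rw [iidProb, Set.eq_univ_of_forall hE, Set.indicator_univ]
  exact iidExp_const hp 1

lemma iidProb_eq_one_sub_compl (hp : ∑ d, p d = 1) (E : Set (Fin s → D)) :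
    iidProb p E = 1 - iidProb p Eᶜ := by
  rw [eq_sub_iff_add_eq, iidProb, iidProb, ← iidExp_add]
  exact (congrArg (iidExp p) (Set.indicator_self_add_compl E 1)).trans (iidExp_const hp 1)

lemma iidProb_mul_le_iidExp (hp : ∀ d, 0 ≤ p d) {F : (Fin s → D) → ℝ} (hF : ∀ y, 0 ≤ F y)
    {E : Set (Fin s → D)} {t : ℝ} (ht : ∀ y ∈ E, t ≤ F y) :
    iidProb p E * t ≤ iidExp p F := by
  rw [mul_comm, iidProb, ← iidExp_const_mul]
  refine iidExp_mono hp fun y => ?_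
  by_cases hy : y ∈ E
  · simpa [hy] using ht y hy
  · simpa [hy] using hF y

lemma one_sub_sq_div_le_iidProb (hp : p ∈ stdSimplex ℝ D) {F : (Fin s → D) → ℝ} {t : ℝ}
    (ht : 0 < t) {E : Set (Fin s → D)} (hE : ∀ y ∉ E, t ≤ |F y|) :
    1 - iidExp p (fun y => F y ^ 2) / t ^ 2 ≤ iidProb p E := by
  have hmarkov : iidProb p Eᶜ * t ^ 2 ≤ iidExp p fun y => F y ^ 2 :=
    iidProb_mul_le_iidExp hp.1 (fun y => sq_nonneg _) fun y hy =>
      (pow_le_pow_left₀ ht.le (hE y hy) 2).trans_eq (sq_abs _)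
  rw [iidProb_eq_one_sub_compl hp.2]
  exact sub_le_sub_left ((le_div_iff₀ (by positivity)).2 hmarkov) 1

lemma five_sixths_le_iidProb (hp : p ∈ stdSimplex ℝ D) {F : (Fin s → D) → ℝ} {t : ℝ} (ht : 0 < t)
    (hF : iidExp p (fun y => F y ^ 2) ≤ t ^ 2 / 6) {E : Set (Fin s → D)}
    (hE : ∀ y ∉ E, t ≤ |F y|) : 5 / 6 ≤ iidProb p E := by
  have hdiv : iidExp p (fun y => F y ^ 2) / t ^ 2 ≤ 1 / 6 := by
    rw [div_le_iff₀ (by positivity)]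
    linarith
  linarith [one_sub_sq_div_le_iidProb hp ht hE]

lemma sum_mul_sub_mean (hp : ∑ d, p d = 1) (f : D → ℝ) :
    ∑ d, p d * (f d - ∑ e, p e * f e) = 0 := by
  simp [mul_sub, Finset.sum_sub_distrib, ← Finset.sum_mul, hp]

lemma sum_mul_sub_mean_sq_le (hp : ∑ d, p d = 1) (f : D → ℝ) :
    ∑ d, p d * (f d - ∑ e, p e * f e) ^ 2 ≤ ∑ d, p d * f d ^ 2 := by
  set μ := ∑ e, p e * f e with hμ
  have hvar : ∑ d, p d * (f d - μ) ^ 2 = ∑ d, p d * f d ^ 2 - μ ^ 2 := by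
    calc ∑ d, p d * (f d - μ) ^ 2
        = ∑ d, p d * f d ^ 2 - 2 * μ * ∑ d, p d * f d + μ ^ 2 * ∑ d, p d := by
          simp only [Finset.mul_sum, ← Finset.sum_sub_distrib, ← Finset.sum_add_distrib]
          exact Finset.sum_congr rfl fun d _ => by ring
      _ = _ := by rw [hp, ← hμ]; ring
  linarith [sq_nonneg μ]

lemma iidExp_sum_sq (hp : ∑ d, p d = 1) {l : D → ℝ} (hl : ∑ d, p d * l d = 0) :
    iidExp p (fun y : Fin s → D => (∑ j, l (y j)) ^ 2) = s * ∑ d, p d * l d ^ 2 := by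
  induction s with
  | zero => simp [iidExp]
  | succ s ih =>
    have hcons (a : D) :
        iidExp p (fun y : Fin s → D => (∑ j, l (Matrix.vecCons a y j)) ^ 2) =
          l a ^ 2 + 2 * iidExp p (fun y : Fin s → D => ∑ j, l (y j)) * l a +
            s * ∑ d, p d * l d ^ 2 := by
      simp only [← ih, Fin.sum_univ_succ, Matrix.cons_val_zero, Matrix.cons_val_succ, add_sq,
        iidExp_add, iidExp_const hp, iidExp_const_mul]
      ring
    calc iidExp p (fun y : Fin (s + 1) → D => (∑ j, l (y j)) ^ 2)
        = ∑ a, p a * l a ^ 2 + 2 * iidExp p (fun y : Fin s → D => ∑ j, l (y j)) * ∑ a, p a * l a +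
            (∑ a, p a) * (s * ∑ d, p d * l d ^ 2) := by
          rw [iidExp_succ, Finset.mul_sum, Finset.sum_mul, ← Finset.sum_add_distrib,
            ← Finset.sum_add_distrib]
          exact Finset.sum_congr rfl fun a _ => by rw [hcons]; ring
      _ = _ := by rw [hl, hp]; push_cast; ring

/-- The sum of the kernel `κ` over the ordered pairs of distinct samples. The diagonal is subtracted
rather than excluded, which turns identities for it into identities of full sums. -/
def offDiagSum {D : Type*} (κ : D → D → ℝ) (y : Fin s → D) : ℝ :=
  (∑ j, ∑ k, κ (y j) (y k)) - ∑ j, κ (y j) (y j)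

lemma offDiagSum_vecCons {D : Type*} {κ : D → D → ℝ} (hκ : ∀ a b, κ a b = κ b a) (a : D)
    (y : Fin s → D) :
    offDiagSum κ (Matrix.vecCons a y) = offDiagSum κ y + 2 * ∑ k, κ a (y k) := by
  simp only [offDiagSum, Fin.sum_univ_succ, Matrix.cons_val_zero, Matrix.cons_val_succ,
    Finset.sum_add_distrib, hκ _ a]
  ring

lemma sum_mul_iidExp_mul_kernel_eq_zero {κ : D → D → ℝ} (hdeg : ∀ b, ∑ a, p a * κ a b = 0)
    (F : (Fin s → D) → ℝ) : ∑ a, p a * iidExp p (fun y => F y * ∑ k, κ a (y k)) = 0 := by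
  calc ∑ a, p a * iidExp p (fun y => F y * ∑ k, κ a (y k))
      = iidExp p fun y => F y * ∑ k, ∑ a, p a * κ a (y k) := by
        simp only [← iidExp_const_mul, ← iidExp_sum]
        congr 1 with y
        rw [Finset.sum_comm, Finset.mul_sum]
        exact Finset.sum_congr rfl fun a _ => by rw [← Finset.mul_sum]; ring
    _ = 0 := by simp [hdeg, iidExp]

lemma iidExp_offDiagSum_sq (hp : ∑ d, p d = 1) {κ : D → D → ℝ} (hκ : ∀ a b, κ a b = κ b a)
    (hdeg : ∀ a, ∑ b, p b * κ a b = 0) :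
    iidExp p (fun y : Fin s → D => offDiagSum κ y ^ 2) =
      2 * s * (s - 1) * ∑ a, p a * ∑ b, p b * κ a b ^ 2 := by
  induction s with
  | zero => simp [iidExp, offDiagSum]
  | succ s ih =>
    have hcons (a : D) :
        iidExp p (fun y : Fin s → D => offDiagSum κ (Matrix.vecCons a y) ^ 2) =
          iidExp p (fun y : Fin s → D => offDiagSum κ y ^ 2) +
            4 * iidExp p (fun y : Fin s → D => offDiagSum κ y * ∑ k, κ a (y k)) +
            4 * (s * ∑ b, p b * κ a b ^ 2) := by
      rw [← iidExp_sum_sq hp (hdeg a), ← iidExp_const_mul, ← iidExp_const_mul, ← iidExp_add,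
        ← iidExp_add]
      congr 1 with y
      rw [offDiagSum_vecCons hκ]
      ring
    have hcross := sum_mul_iidExp_mul_kernel_eq_zero (p := p) (s := s) (κ := κ)
      (fun b => by simpa only [hκ b] using hdeg b) (offDiagSum κ)
    calc iidExp p (fun y : Fin (s + 1) → D => offDiagSum κ y ^ 2)
        = (∑ a, p a) * iidExp p (fun y : Fin s → D => offDiagSum κ y ^ 2) +
            4 * ∑ a, p a * iidExp p (fun y : Fin s → D => offDiagSum κ y * ∑ k, κ a (y k)) +
            4 * s * ∑ a, p a * ∑ b, p b * κ a b ^ 2 := by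
          rw [iidExp_succ, Finset.mul_sum, Finset.mul_sum, Finset.sum_mul,
            ← Finset.sum_add_distrib, ← Finset.sum_add_distrib]
          exact Finset.sum_congr rfl fun a _ => by rw [hcons]; ring
      _ = _ := by rw [hp, hcross, ih]; push_cast; ring

end Expectation

section L2Statistic

variable {D : Type*} [Fintype D] [DecidableEq D] {p q : D → ℝ} {s : ℕ}

lemma sum_mul_occurrences (f : D → ℝ) (y : Fin s → D) :
    ∑ d, f d * (occurrences y d : ℝ) = ∑ j, f (y j) := by
  simp only [occurrences, Finset.card_filter, Nat.cast_sum, Finset.mul_sum]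
  rw [Finset.sum_comm]
  simp

lemma sum_occurrences_mul_sub_one (y : Fin s → D) :
    ∑ d, (occurrences y d : ℝ) * ((occurrences y d : ℝ) - 1) =
      offDiagSum (fun a b => if a = b then 1 else 0) y := by
  have hcount (a : D) : (occurrences y a : ℝ) = ∑ k, if a = y k then 1 else 0 := by
    simp [occurrences, eq_comm (a := a)]
  rw [Finset.sum_congr rfl fun d _ => mul_comm _ _, sum_mul_occurrences, Finset.sum_sub_distrib]
  simp only [hcount, offDiagSum, if_true]

lemma l2Statistic_eq (q : D → ℝ) (y : Fin s → D) :
    l2Statistic q y =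
      (s * (s - 1) : ℝ)⁻¹ * offDiagSum (fun a b => if a = b then 1 else 0) y -
        2 / s * ∑ j, q (y j) + ∑ d, q d ^ 2 := by
  rw [← sum_occurrences_mul_sub_one, ← sum_mul_occurrences, Finset.mul_sum, Finset.mul_sum,
    ← Finset.sum_sub_distrib, ← Finset.sum_add_distrib]
  exact Finset.sum_congr rfl fun d _ => by ring

lemma l2Statistic_le_of_lt_two (hs : s < 2) (hq : ∀ d, 0 ≤ q d) (y : Fin s → D) :
    l2Statistic q y ≤ ∑ d, q d ^ 2 := by
  have hzero : (s * (s - 1) : ℝ) = 0 := by interval_cases s <;> simp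
  have hsum : 0 ≤ 2 / (s : ℝ) * ∑ j, q (y j) :=
    mul_nonneg (by positivity) (Finset.sum_nonneg fun _ _ => hq _)
  rw [l2Statistic_eq, hzero, inv_zero, zero_mul]
  linarith

/-- The inner product of the centred indicator vectors `e_a - p` and `e_b - p`. It is the kernel of
the degenerate part in the Hoeffding decomposition of `l2Statistic`. -/
def centredKernel (p : D → ℝ) (a b : D) : ℝ :=
  (if a = b then 1 else 0) - p a - p b + ∑ d, p d ^ 2

lemma centredKernel_comm (a b : D) : centredKernel p a b = centredKernel p b a := by
  simp only [centredKernel, eq_comm (a := a)]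
  ring

lemma centredKernel_eq_sub_mean (a b : D) :
    centredKernel p a b =
      ((if a = b then 1 else 0) - p b) - ∑ c, p c * ((if a = c then 1 else 0) - p c) := by
  simp only [centredKernel, mul_sub, mul_ite, mul_one, mul_zero, Finset.sum_sub_distrib,
    Finset.sum_ite_eq, Finset.mem_univ, if_true, sq]
  ring

lemma sum_mul_centredKernel (hp : ∑ d, p d = 1) (a : D) :
    ∑ b, p b * centredKernel p a b = 0 := by
  simp only [centredKernel_eq_sub_mean]
  exact sum_mul_sub_mean hp _

lemma sum_sum_mul_centredKernel_sq_le (hp : p ∈ stdSimplex ℝ D) :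
    ∑ a, p a * ∑ b, p b * centredKernel p a b ^ 2 ≤ ∑ d, p d ^ 2 := by
  have hrow (a : D) :
      ∑ b, p b * centredKernel p a b ^ 2 ≤ p a - 2 * p a ^ 2 + ∑ b, p b ^ 3 := by
    have hterm (b : D) : p b * ((if a = b then 1 else 0) - p b) ^ 2 =
        (if a = b then p b - 2 * p b ^ 2 else 0) + p b ^ 3 := by
      split_ifs <;> ring
    simp only [centredKernel_eq_sub_mean]
    refine (sum_mul_sub_mean_sq_le hp.2 _).trans_eq ?_
    simp [hterm, Finset.sum_add_distrib]
  calc ∑ a, p a * ∑ b, p b * centredKernel p a b ^ 2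
      ≤ ∑ a, p a * (p a - 2 * p a ^ 2 + ∑ b, p b ^ 3) :=
        Finset.sum_le_sum fun a _ => mul_le_mul_of_nonneg_left (hrow a) (hp.1 a)
    _ = ∑ a, p a ^ 2 - 2 * ∑ a, p a ^ 3 + (∑ a, p a) * ∑ b, p b ^ 3 := by
        rw [Finset.mul_sum, Finset.sum_mul, ← Finset.sum_sub_distrib, ← Finset.sum_add_distrib]
        exact Finset.sum_congr rfl fun a _ => by ring
    _ ≤ ∑ d, p d ^ 2 := by
        rw [hp.2]
        linarith [Finset.sum_nonneg fun a (_ : a ∈ Finset.univ) => pow_nonneg (hp.1 a) 3]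

lemma offDiagSum_centredKernel (p : D → ℝ) (y : Fin s → D) :
    offDiagSum (centredKernel p) y =
      offDiagSum (fun a b => if a = b then 1 else 0) y - 2 * (s - 1) * ∑ j, p (y j) +
        s * (s - 1) * ∑ d, p d ^ 2 := by
  simp only [offDiagSum, centredKernel, Finset.sum_sub_distrib, Finset.sum_add_distrib,
    Finset.sum_const, Finset.card_univ, Fintype.card_fin, nsmul_eq_mul, if_true, ← Finset.mul_sum]
  ring

/-- The square of the `ℓ₂`-distance, the quantity that `l2Statistic` estimates. -/
def l2DistSq {D : Type*} [Fintype D] (p q : D → ℝ) : ℝ := ∑ d, (p d - q d) ^ 2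

lemma l2Statistic_sub_l2DistSq (hs : 2 ≤ s) (p q : D → ℝ) (y : Fin s → D) :
    l2Statistic q y - l2DistSq p q =
      (s * (s - 1) : ℝ)⁻¹ * offDiagSum (centredKernel p) y +
        2 / s * ∑ j, ((p (y j) - q (y j)) - ∑ d, p d * (p d - q d)) := by
  have hs₂ : (2 : ℝ) ≤ s := by exact_mod_cast hs
  have hs₀ : (s : ℝ) ≠ 0 := by linarith
  have hs₁ : (s : ℝ) - 1 ≠ 0 := by linarith
  have hdist : l2DistSq p q = 2 * ∑ d, p d * (p d - q d) - ∑ d, p d ^ 2 + ∑ d, q d ^ 2 := by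
    rw [l2DistSq, Finset.mul_sum, ← Finset.sum_sub_distrib, ← Finset.sum_add_distrib]
    exact Finset.sum_congr rfl fun d _ => by ring
  rw [l2Statistic_eq, offDiagSum_centredKernel, hdist, Finset.sum_sub_distrib,
    Finset.sum_sub_distrib, Finset.sum_const, Finset.card_univ, Fintype.card_fin, nsmul_eq_mul]
  field_simp
  ring

lemma iidExp_l2Statistic_sub_sq_le (hp : p ∈ stdSimplex ℝ D) (hs : 2 ≤ s) (q : D → ℝ) :
    iidExp p (fun y : Fin s → D => (l2Statistic q y - l2DistSq p q) ^ 2) ≤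
      4 * (∑ d, p d ^ 2) / (s * (s - 1)) + 8 * (∑ d, p d * (p d - q d) ^ 2) / s := by
  have hs₂ : (2 : ℝ) ≤ s := by exact_mod_cast hs
  have hs₁ : (0 : ℝ) < (s : ℝ) - 1 := by linarith
  set l : D → ℝ := fun d => (p d - q d) - ∑ e, p e * (p e - q e)
  have hl : ∑ d, p d * l d = 0 := sum_mul_sub_mean hp.2 _
  calc iidExp p (fun y : Fin s → D => (l2Statistic q y - l2DistSq p q) ^ 2)
      ≤ iidExp p (fun y : Fin s → D =>
          2 * ((s * (s - 1) : ℝ)⁻¹) ^ 2 * offDiagSum (centredKernel p) y ^ 2 +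
            2 * (2 / s) ^ 2 * (∑ j, l (y j)) ^ 2) := by
        refine iidExp_mono hp.1 fun y => ?_
        rw [l2Statistic_sub_l2DistSq hs]
        exact add_sq_le.trans_eq (by ring)
    _ = 2 * ((s * (s - 1) : ℝ)⁻¹) ^ 2 *
          (2 * s * (s - 1) * ∑ a, p a * ∑ b, p b * centredKernel p a b ^ 2) +
        2 * (2 / s) ^ 2 * (s * ∑ d, p d * l d ^ 2) := by
        rw [iidExp_add, iidExp_const_mul, iidExp_const_mul,
          iidExp_offDiagSum_sq hp.2 centredKernel_comm (sum_mul_centredKernel hp.2),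
          iidExp_sum_sq hp.2 hl]
    _ ≤ 2 * ((s * (s - 1) : ℝ)⁻¹) ^ 2 * (2 * s * (s - 1) * ∑ d, p d ^ 2) +
        2 * (2 / s) ^ 2 * (s * ∑ d, p d * (p d - q d) ^ 2) := by
        gcongr ?_ * (?_ * ?_) + ?_ * (?_ * ?_)
        · exact sum_sum_mul_centredKernel_sq_le hp
        · exact sum_mul_sub_mean_sq_le hp.2 _
    _ = 4 * (∑ d, p d ^ 2) / (s * (s - 1)) + 8 * (∑ d, p d * (p d - q d) ^ 2) / s := by
        field_simp
        ring

lemma iidExp_l2Statistic_sub_sq_le_of_lt_add_one (hp : p ∈ stdSimplex ℝ D) (hs : 2 ≤ s)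
    (q : D → ℝ) {x : ℝ} (hx : 0 < x) (hxs : x < s + 1) :
    iidExp p (fun y : Fin s → D => (l2Statistic q y - l2DistSq p q) ^ 2) ≤
      18 * (∑ d, p d ^ 2) / x ^ 2 + 12 * (∑ d, p d * (p d - q d) ^ 2) / x := by
  have hs₂ : (2 : ℝ) ≤ s := by exact_mod_cast hs
  have hnorm : 0 ≤ ∑ d, p d ^ 2 := Finset.sum_nonneg fun d _ => sq_nonneg _
  have hlin : 0 ≤ ∑ d, p d * (p d - q d) ^ 2 :=
    Finset.sum_nonneg fun d _ => mul_nonneg (hp.1 d) (sq_nonneg _)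
  refine (iidExp_l2Statistic_sub_sq_le hp hs q).trans (add_le_add ?_ ?_)
  · rw [div_le_div_iff₀ (by nlinarith) (by positivity)]
    have hx₂ : 4 * x ^ 2 ≤ 18 * (s * (s - 1) : ℝ) := by nlinarith
    nlinarith [mul_le_mul_of_nonneg_left hx₂ hnorm]
  · rw [div_le_div_iff₀ (by linarith) hx]
    have hx₁ : 8 * x ≤ 12 * (s : ℝ) := by linarith
    nlinarith [mul_le_mul_of_nonneg_left hx₁ hlin]

end L2Statistic

section IdentityTester

variable {D : Type*} [Fintype D] {p q : D → ℝ} {s : ℕ} {ε : ℝ}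

lemma sum_sq_le_of_le (hp : p ∈ stdSimplex ℝ D) {c : ℝ} (hc : ∀ d, p d ≤ c) :
    ∑ d, p d ^ 2 ≤ c := by
  calc ∑ d, p d ^ 2 ≤ ∑ d, c * p d := Finset.sum_le_sum fun d _ => by
        rw [sq]; exact mul_le_mul_of_nonneg_right (hc d) (hp.1 d)
    _ = c := by rw [← Finset.mul_sum, hp.2, mul_one]

lemma sum_mul_sub_sq_le_mul_l2DistSq {c : ℝ} (hc : ∀ d, p d ≤ c) :
    ∑ d, p d * (p d - q d) ^ 2 ≤ c * l2DistSq p q := by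
  rw [l2DistSq, Finset.mul_sum]
  exact Finset.sum_le_sum fun d _ => mul_le_mul_of_nonneg_right (hc d) (sq_nonneg _)

lemma sum_sq_le_two_mul_sum_sq_add (p q : D → ℝ) :
    ∑ d, p d ^ 2 ≤ 2 * ∑ d, q d ^ 2 + 2 * l2DistSq p q := by
  rw [l2DistSq, Finset.mul_sum, Finset.mul_sum, ← Finset.sum_add_distrib]
  exact Finset.sum_le_sum fun d _ => by nlinarith [sq_nonneg (p d - 2 * q d)]

lemma sub_le_sqrt_l2DistSq (p q : D → ℝ) (d : D) : p d - q d ≤ √(l2DistSq p q) :=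
  Real.le_sqrt_of_sq_le <| Finset.single_le_sum (f := fun d => (p d - q d) ^ 2)
    (fun _ _ => sq_nonneg _) (Finset.mem_univ d)

lemma sq_l1Dist_le_card_mul_l2DistSq (p q : D → ℝ) :
    l1Dist p q ^ 2 ≤ Fintype.card D * l2DistSq p q := by
  simpa only [l1Dist, l2DistSq, sq_abs, Finset.card_univ] using
    sq_sum_le_card_mul_sum_sq (s := Finset.univ) (f := fun d => |p d - q d|)

lemma acceptance_variance_le {N : ℝ} (hN : 1 ≤ N) (hε : 0 < ε) :
    18 * (9 / N) / (5000 * (√N / ε ^ 2)) ^ 2 +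
      12 * (9 / N * (ε ^ 2 / (12 * N))) / (5000 * (√N / ε ^ 2)) ≤
        (5 * ε ^ 2 / (12 * N)) ^ 2 / 6 := by
  have hN₀ : 0 < N := by linarith
  calc 18 * (9 / N) / (5000 * (√N / ε ^ 2)) ^ 2 +
        12 * (9 / N * (ε ^ 2 / (12 * N))) / (5000 * (√N / ε ^ 2))
      = 18 * 9 / 5000 ^ 2 * (ε ^ 4 / N ^ 2) + 9 / 5000 * (ε ^ 4 / N ^ 2 / √N) := by
        rw [mul_pow, div_pow, Real.sq_sqrt hN₀.le]
        field_simp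
    _ ≤ 18 * 9 / 5000 ^ 2 * (ε ^ 4 / N ^ 2) + 9 / 5000 * (ε ^ 4 / N ^ 2) := by
        gcongr _ + _ * ?_
        exact div_le_self (by positivity) (Real.one_le_sqrt.2 hN)
    _ ≤ 25 / 864 * (ε ^ 4 / N ^ 2) := by
        rw [← add_mul]
        gcongr
        norm_num
    _ = (5 * ε ^ 2 / (12 * N)) ^ 2 / 6 := by
        field_simp
        norm_num

lemma rejection_variance_le {N T : ℝ} (hN : 1 ≤ N) (hε : 0 < ε) (hε₂ : ε ≤ 2)
    (hT : ε ^ 2 ≤ N * T) :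
    18 * (6 / N + 2 * T) / (5000 * (√N / ε ^ 2)) ^ 2 +
      12 * ((3 / N + √T) * T) / (5000 * (√N / ε ^ 2)) ≤ (T / 2) ^ 2 / 6 := by
  have hN₀ : 0 < N := by linarith
  have hT₀ : 0 < T := pos_of_mul_pos_right ((pow_pos hε 2).trans_le hT) hN₀.le
  have hfar : ε ^ 2 / N ≤ T := by rwa [div_le_iff₀' hN₀]
  have hfar' : ε / √N ≤ √T := by
    rw [← Real.sqrt_sq hε.le, ← Real.sqrt_div (sq_nonneg ε)]
    exact Real.sqrt_le_sqrt hfar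
  have hε₄ : ε ^ 2 ≤ 4 := by nlinarith
  calc 18 * (6 / N + 2 * T) / (5000 * (√N / ε ^ 2)) ^ 2 +
        12 * ((3 / N + √T) * T) / (5000 * (√N / ε ^ 2))
      = 108 / 5000 ^ 2 * (ε ^ 2 / N) ^ 2 + 36 / 5000 ^ 2 * (T * (ε ^ 2 / N) * ε ^ 2) +
          36 / 5000 * (ε ^ 2 / N * T / √N) + 12 / 5000 * (√T * T * (ε / √N) * ε) := by
        rw [mul_pow, div_pow, Real.sq_sqrt hN₀.le]
        field_simp
        ring
    _ ≤ 108 / 5000 ^ 2 * T ^ 2 + 36 / 5000 ^ 2 * (T * T * 4) + 36 / 5000 * (T * T) +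
          12 / 5000 * (√T * T * √T * 2) := by
        gcongr ?_ * ?_ ^ 2 + ?_ * (?_ * ?_ * ?_) + ?_ * ?_ + ?_ * (?_ * ?_ * ?_ * ?_)
        refine (div_le_self (by positivity) (Real.one_le_sqrt.2 hN)).trans ?_
        gcongr
    _ = (108 / 5000 ^ 2 + 144 / 5000 ^ 2 + 36 / 5000 + 24 / 5000) * T ^ 2 := by
        linear_combination 24 / 5000 * T * Real.sq_sqrt hT₀.le
    _ ≤ (T / 2) ^ 2 / 6 := by nlinarith [sq_nonneg T]

variable [DecidableEq D] [Nonempty D]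

lemma identityTester_accepts_of_lt_two (hs₂ : s < 2) (hε : 0 < ε) (hq : q ∈ stdSimplex ℝ D)
    (hqN : ∀ d, q d ≤ 3 / Fintype.card D) (hs : 5000 * (√(Fintype.card D) / ε ^ 2) < s + 1)
    (y : Fin s → D) : identityTester q ε y = true := by
  have hN : (1 : ℝ) ≤ Fintype.card D := by exact_mod_cast Fintype.card_pos
  have hs₁ : (s : ℝ) ≤ 1 := by exact_mod_cast Nat.lt_succ_iff.1 hs₂
  have hε₂ : 6 ≤ ε ^ 2 := by
    rw [← mul_div_assoc, div_lt_iff₀ (by positivity)] at hs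
    nlinarith [Real.one_le_sqrt.2 hN]
  rw [identityTester, decide_eq_true_eq]
  calc l2Statistic q y ≤ ∑ d, q d ^ 2 := l2Statistic_le_of_lt_two hs₂ hq.1 y
    _ ≤ 3 / Fintype.card D := sum_sq_le_of_le hq hqN
    _ ≤ ε ^ 2 / (2 * Fintype.card D) := by
        rw [div_le_div_iff₀ (by positivity) (by positivity)]
        nlinarith

lemma five_sixths_le_iidProb_identityTester_accepts (hε : 0 < ε) (hp : p ∈ stdSimplex ℝ D)
    (hq : q ∈ stdSimplex ℝ D) (hpN : ∀ d, p d ≤ 9 / Fintype.card D)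
    (hqN : ∀ d, q d ≤ 3 / Fintype.card D)
    (hpq : l2DistSq p q ≤ ε ^ 2 / (12 * Fintype.card D))
    (hs : 5000 * (√(Fintype.card D) / ε ^ 2) < s + 1) :
    5 / 6 ≤ iidProb p {y : Fin s → D | identityTester q ε y = true} := by
  have hN : (1 : ℝ) ≤ Fintype.card D := by exact_mod_cast Fintype.card_pos
  rcases lt_or_ge s 2 with hs₂ | hs₂
  · have hall (y : Fin s → D) : y ∈ {y | identityTester q ε y = true} :=
      identityTester_accepts_of_lt_two hs₂ hε hq hqN hs y
    rw [iidProb_eq_one hp.2 hall]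
    norm_num
  have hlin : ∑ d, p d * (p d - q d) ^ 2 ≤
      9 / Fintype.card D * (ε ^ 2 / (12 * Fintype.card D)) :=
    (sum_mul_sub_sq_le_mul_l2DistSq hpN).trans (by gcongr)
  refine five_sixths_le_iidProb hp (F := fun y => l2Statistic q y - l2DistSq p q)
    (t := 5 * ε ^ 2 / (12 * Fintype.card D)) (by positivity) ?_ fun y hy => ?_
  · refine (iidExp_l2Statistic_sub_sq_le_of_lt_add_one hp hs₂ q (by positivity) hs).trans
      (le_trans ?_ (acceptance_variance_le hN hε))
    gcongr
    exact sum_sq_le_of_le hp hpN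
  · rw [Set.mem_ofPred_eq, identityTester, decide_eq_true_eq, not_le] at hy
    have hgap : 5 * ε ^ 2 / (12 * Fintype.card D) =
        ε ^ 2 / (2 * Fintype.card D) - ε ^ 2 / (12 * Fintype.card D) := by
      field_simp
      norm_num
    exact le_abs.2 (Or.inl (by linarith))

lemma five_sixths_le_iidProb_identityTester_rejects (hε : 0 < ε) (hε₂ : ε ≤ 2)
    (hp : p ∈ stdSimplex ℝ D) (hq : q ∈ stdSimplex ℝ D) (hqN : ∀ d, q d ≤ 3 / Fintype.card D)
    (hpq : ε ≤ l1Dist p q) (hs : 5000 * (√(Fintype.card D) / ε ^ 2) < s + 1) :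
    5 / 6 ≤ iidProb p {y : Fin s → D | identityTester q ε y = false} := by
  have hN : (1 : ℝ) ≤ Fintype.card D := by exact_mod_cast Fintype.card_pos
  set N : ℝ := (Fintype.card D : ℝ)
  set T := l2DistSq p q
  have hT : ε ^ 2 ≤ N * T :=
    (pow_le_pow_left₀ hε.le hpq 2).trans (sq_l1Dist_le_card_mul_l2DistSq p q)
  have hT₀ : 0 < T := pos_of_mul_pos_right ((pow_pos hε 2).trans_le hT) (by positivity)
  have hs₂ : 2 ≤ s := by
    have hratio : 1 / 4 ≤ √N / ε ^ 2 := by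
      rw [div_le_div_iff₀ (by norm_num) (by positivity)]
      nlinarith [Real.one_le_sqrt.2 hN]
    exact_mod_cast (by linarith : (2 : ℝ) ≤ s)
  have hnorm : ∑ d, p d ^ 2 ≤ 6 / N + 2 * T :=
    (sum_sq_le_two_mul_sum_sq_add p q).trans (by
      linarith [sum_sq_le_of_le hq hqN, show 6 / N = 2 * (3 / N) by ring])
  have hlin : ∑ d, p d * (p d - q d) ^ 2 ≤ (3 / N + √T) * T :=
    sum_mul_sub_sq_le_mul_l2DistSq fun d => by linarith [hqN d, sub_le_sqrt_l2DistSq p q d]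
  refine five_sixths_le_iidProb hp (F := fun y => l2Statistic q y - T) (t := T / 2)
    (by positivity) ?_ fun y hy => ?_
  · refine (iidExp_l2Statistic_sub_sq_le_of_lt_add_one hp hs₂ q (by positivity) hs).trans
      (le_trans ?_ (rejection_variance_le hN hε hε₂ hT))
    gcongr
  · rw [Set.mem_ofPred_eq, Bool.not_eq_false, identityTester, decide_eq_true_eq] at hy
    have hthreshold : ε ^ 2 / (2 * N) ≤ T / 2 := by
      rw [div_le_div_iff₀ (by positivity) (by norm_num)]
      linarith
    exact le_abs.2 (Or.inr (by linarith))

end IdentityTester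

section Mixture

variable {D : Type*} [Fintype D]

lemma l1Dist_nonneg (p q : D → ℝ) : 0 ≤ l1Dist p q :=
  Finset.sum_nonneg fun _ _ => abs_nonneg _

lemma abs_sub_le_l1Dist (p q : D → ℝ) (d : D) : |p d - q d| ≤ l1Dist p q :=
  Finset.single_le_sum (f := fun d => |p d - q d|) (fun _ _ => abs_nonneg _) (Finset.mem_univ d)

lemma l1Dist_le_two {p q : D → ℝ} (hp : p ∈ stdSimplex ℝ D) (hq : q ∈ stdSimplex ℝ D) :
    l1Dist p q ≤ 2 := by
  calc l1Dist p q ≤ ∑ d, (p d + q d) := Finset.sum_le_sum fun d _ =>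
        abs_le.2 ⟨by linarith [hp.1 d, hq.1 d], by linarith [hp.1 d, hq.1 d]⟩
    _ = 2 := by rw [Finset.sum_add_distrib, hp.2, hq.2]; norm_num

lemma l2DistSq_le_mul_l1Dist {p q : D → ℝ} {c : ℝ} (hc : ∀ d, |p d - q d| ≤ c) :
    l2DistSq p q ≤ c * l1Dist p q := by
  rw [l2DistSq, l1Dist, Finset.mul_sum]
  refine Finset.sum_le_sum fun d _ => ?_
  rw [← sq_abs, sq]
  exact mul_le_mul_of_nonneg_right (hc d) (abs_nonneg _)

variable {n : ℕ} {q₁ q₂ q : Fin n → ℝ} {α t : ℝ}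

lemma pos_of_mem_stdSimplex (hq : q ∈ stdSimplex ℝ (Fin n)) : 0 < n := by
  rcases Nat.eq_zero_or_pos n with rfl | hn
  · simpa using hq.2
  · exact hn

lemma mixture_mem_stdSimplex (h₁ : q₁ ∈ stdSimplex ℝ (Fin n)) (h₂ : q₂ ∈ stdSimplex ℝ (Fin n))
    (hα : α ∈ Set.Icc (0 : ℝ) 1) : mixture q₁ q₂ α ∈ stdSimplex ℝ (Fin n) :=
  convex_stdSimplex ℝ (Fin n) h₁ h₂ (sub_nonneg.2 hα.2) hα.1 (by ring)

lemma abs_mixture_sub_left (ht : 0 ≤ t) (i : Fin n) :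
    |mixture q q₂ t i - q i| = t * |q i - q₂ i| := by
  rw [mixture, show (1 - t) * q i + t * q₂ i - q i = -(t * (q i - q₂ i)) by ring, abs_neg, abs_mul,
    abs_of_nonneg ht]

lemma l1Dist_mixture_left (ht : 0 ≤ t) : l1Dist (mixture q q₂ t) q = t * l1Dist q q₂ := by
  simp only [l1Dist, abs_mixture_sub_left ht, Finset.mul_sum]

lemma l1Dist_mixture_right (hα : α ≤ 1) :
    l1Dist (mixture q₁ q₂ α) q₂ = (1 - α) * l1Dist q₁ q₂ := by
  simp only [l1Dist, Finset.mul_sum]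
  refine Finset.sum_congr rfl fun i _ => ?_
  rw [mixture, show (1 - α) * q₁ i + α * q₂ i - q₂ i = (1 - α) * (q₁ i - q₂ i) by ring, abs_mul,
    abs_of_nonneg (sub_nonneg.2 hα)]

lemma l1Dist_eq_two_mul_heavySet (h₁ : q₁ ∈ stdSimplex ℝ (Fin n))
    (h₂ : q₂ ∈ stdSimplex ℝ (Fin n)) :
    l1Dist q₁ q₂ = 2 * ((∑ i ∈ heavySet q₁ q₂, q₁ i) - ∑ i ∈ heavySet q₁ q₂, q₂ i) := by
  have habs (i : Fin n) :
      |q₁ i - q₂ i| = 2 * (if q₂ i < q₁ i then q₁ i - q₂ i else 0) - (q₁ i - q₂ i) := by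
    split_ifs with hi
    · rw [abs_of_pos (sub_pos.2 hi)]; ring
    · rw [abs_of_nonpos (by linarith)]; ring
  simp only [l1Dist, habs, Finset.sum_sub_distrib, ← Finset.mul_sum, h₁.2, h₂.2, sub_self, sub_zero,
    ← Finset.sum_filter, heavySet]

lemma exists_mixture_eq_mixture {β ε : ℝ} (hε : 0 ≤ ε) (hα : α ∈ Set.Icc (0 : ℝ) 1)
    (hβ : β ≤ 1) (hαβ : α ≤ β) (hclose : (β - α) * l1Dist q₁ q₂ ≤ ε) :
    ∃ t ∈ Set.Icc (0 : ℝ) 1, mixture q₁ q₂ β = mixture (mixture q₁ q₂ α) q₂ t ∧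
      t * l1Dist (mixture q₁ q₂ α) q₂ ≤ ε := by
  rcases hα.2.eq_or_lt with rfl | hα₁
  · obtain rfl : β = 1 := le_antisymm hβ hαβ
    refine ⟨0, by simp, ?_, by simpa using hε⟩
    funext i
    simp [mixture]
  · have hpos : 0 < 1 - α := sub_pos.2 hα₁
    refine ⟨(β - α) / (1 - α), ⟨div_nonneg (sub_nonneg.2 hαβ) hpos.le, ?_⟩, ?_, ?_⟩
    · rw [div_le_one hpos]
      linarith
    · funext i
      simp only [mixture]
      field_simp
      ring
    · rwa [l1Dist_mixture_right hα.2, ← mul_assoc, div_mul_cancel₀ _ hpos.ne']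

end Mixture

section Reshape

variable {n s : ℕ} {p q q₂ : Fin n → ℝ} {ε t : ℝ}

lemma sum_reshape (a : Fin n → ℕ) [∀ i, NeZero (a i)] (p : Fin n → ℝ) :
    ∑ d, reshape a p d = ∑ i, p i := by
  rw [Fintype.sum_sigma]
  refine Finset.sum_congr rfl fun i _ => ?_
  have ha : (a i : ℝ) ≠ 0 := by exact_mod_cast NeZero.ne (a i)
  simp [reshape, mul_div_cancel₀ _ ha]

lemma reshape_mem_stdSimplex (a : Fin n → ℕ) [∀ i, NeZero (a i)] (hp : p ∈ stdSimplex ℝ (Fin n)) :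
    reshape a p ∈ stdSimplex ℝ (Σ i, Fin (a i)) :=
  ⟨fun d => div_nonneg (hp.1 d.1) (Nat.cast_nonneg _), (sum_reshape a p).trans hp.2⟩

lemma abs_reshape_sub (a : Fin n → ℕ) (d : Σ i, Fin (a i)) :
    |reshape a p d - reshape a q d| = reshape a (fun i => |p i - q i|) d := by
  simp only [reshape, ← sub_div, abs_div, Nat.abs_cast]

lemma l1Dist_reshape (a : Fin n → ℕ) [∀ i, NeZero (a i)] (p q : Fin n → ℝ) :
    l1Dist (reshape a p) (reshape a q) = l1Dist p q := by
  simp only [l1Dist, abs_reshape_sub, sum_reshape]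

lemma cast_buckets (q q₂ : Fin n → ℝ) (i : Fin n) :
    (buckets q q₂ i : ℝ) =
      ⌊(n : ℝ) * q i⌋₊ + ⌊(n : ℝ) * |q i - q₂ i| / l1Dist q q₂⌋₊ + 1 := by
  simp only [buckets, Nat.cast_add, Nat.cast_one]

lemma card_buckets_le (hq : q ∈ stdSimplex ℝ (Fin n)) (q₂ : Fin n → ℝ) :
    (Fintype.card (Σ i, Fin (buckets q q₂ i)) : ℝ) ≤ 3 * n := by
  have hbucket (i : Fin n) :
      (buckets q q₂ i : ℝ) ≤ n * q i + n * |q i - q₂ i| / l1Dist q q₂ + 1 := by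
    rw [cast_buckets]
    gcongr
    · exact Nat.floor_le (mul_nonneg (Nat.cast_nonneg n) (hq.1 i))
    · exact Nat.floor_le (div_nonneg (by positivity) (l1Dist_nonneg q q₂))
  calc (Fintype.card (Σ i, Fin (buckets q q₂ i)) : ℝ)
      = ∑ i, (buckets q q₂ i : ℝ) := by simp [Fintype.card_sigma]
    _ ≤ ∑ i : Fin n, ((n : ℝ) * q i + (n : ℝ) * |q i - q₂ i| / l1Dist q q₂ + 1) :=
        Finset.sum_le_sum fun i _ => hbucket i
    _ = n * 1 + n * (l1Dist q q₂ / l1Dist q q₂) + n := by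
        simp only [mul_div_assoc, Finset.sum_add_distrib, ← Finset.mul_sum, ← Finset.sum_div, hq.2]
        simp [l1Dist]
    _ ≤ n * 1 + n * 1 + n := by
        gcongr
        exact div_self_le_one _
    _ = 3 * n := by ring

lemma mul_le_buckets (q q₂ : Fin n → ℝ) (i : Fin n) : (n : ℝ) * q i ≤ buckets q q₂ i := by
  rw [cast_buckets]
  linarith [Nat.lt_floor_add_one ((n : ℝ) * q i),
    Nat.cast_nonneg (α := ℝ) ⌊(n : ℝ) * |q i - q₂ i| / l1Dist q q₂⌋₊]

lemma mul_abs_sub_le_buckets_mul (q q₂ : Fin n → ℝ) (i : Fin n) :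
    (n : ℝ) * |q i - q₂ i| ≤ buckets q q₂ i * l1Dist q q₂ := by
  rcases (l1Dist_nonneg q q₂).eq_or_lt with hzero | hpos
  · have hi : |q i - q₂ i| = 0 :=
      le_antisymm ((abs_sub_le_l1Dist q q₂ i).trans_eq hzero.symm) (abs_nonneg _)
    rw [hi, ← hzero, mul_zero, mul_zero]
  · rw [← div_le_iff₀ hpos, cast_buckets]
    linarith [Nat.lt_floor_add_one ((n : ℝ) * |q i - q₂ i| / l1Dist q q₂),
      Nat.cast_nonneg (α := ℝ) ⌊(n : ℝ) * q i⌋₊]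

lemma reshape_buckets_le (q q₂ : Fin n → ℝ) (d : Σ i, Fin (buckets q q₂ i)) :
    reshape (buckets q q₂) q d ≤ 1 / n := by
  rw [reshape, div_le_div_iff₀ (by exact_mod_cast NeZero.pos (buckets q q₂ d.1))
    (by exact_mod_cast d.1.pos)]
  linarith [mul_le_buckets q q₂ d.1]

lemma abs_reshape_mixture_sub_le (ht : 0 ≤ t) (d : Σ i, Fin (buckets q q₂ i)) :
    |reshape (buckets q q₂) (mixture q q₂ t) d - reshape (buckets q q₂) q d| ≤
      t * l1Dist q q₂ / n := by
  rw [abs_reshape_sub, reshape, abs_mixture_sub_left ht,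
    div_le_div_iff₀ (by exact_mod_cast NeZero.pos (buckets q q₂ d.1)) (by exact_mod_cast d.1.pos)]
  linarith [mul_le_mul_of_nonneg_left (mul_abs_sub_le_buckets_mul q q₂ d.1) ht]

instance [NeZero n] : Nonempty (Σ i, Fin (buckets q q₂ i)) := ⟨⟨0, 0⟩⟩

lemma div_le_div_card_buckets [NeZero n] (hq : q ∈ stdSimplex ℝ (Fin n)) (q₂ : Fin n → ℝ) {c : ℝ}
    (hc : 0 ≤ c) : c / n ≤ 3 * c / Fintype.card (Σ i, Fin (buckets q q₂ i)) := by
  rw [div_le_div_iff₀ (by exact_mod_cast NeZero.pos n) (by exact_mod_cast Fintype.card_pos)]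
  linarith [mul_le_mul_of_nonneg_left (card_buckets_le hq q₂) hc]

lemma sqrt_card_buckets_div_lt (hq : q ∈ stdSimplex ℝ (Fin n)) (q₂ : Fin n → ℝ)
    (hs : 10000 * (√n / ε ^ 2) < s + 1) :
    5000 * (√(Fintype.card (Σ i, Fin (buckets q q₂ i))) / ε ^ 2) < s + 1 := by
  have hsqrt : √(Fintype.card (Σ i, Fin (buckets q q₂ i))) ≤ 2 * √n := by
    rw [Real.sqrt_le_left (by positivity), mul_pow, Real.sq_sqrt (Nat.cast_nonneg n)]
    linarith [card_buckets_le hq q₂, Nat.cast_nonneg (α := ℝ) n]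
  calc 5000 * (√(Fintype.card (Σ i, Fin (buckets q q₂ i))) / ε ^ 2)
      ≤ 5000 * (2 * √n / ε ^ 2) := by gcongr
    _ = 10000 * (√n / ε ^ 2) := by ring
    _ < s + 1 := hs

/-- The probability that the `ℓ₂` tester for the reshaped `q` outputs `b` when it is given `s`
samples from the reshaped `p`, where the reshaping is the one that belongs to `q` and `q₂`. -/
noncomputable def reshapedTestProb (s : ℕ) (q q₂ : Fin n → ℝ) (ε : ℝ) (p : Fin n → ℝ)
    (b : Bool) : ℝ :=
  iidProb (reshape (buckets q q₂) p)
    {y : Fin s → _ | identityTester (reshape (buckets q q₂) q) ε y = b}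

lemma five_sixths_le_reshapedTestProb_mixture (hε : 0 < ε) (hq : q ∈ stdSimplex ℝ (Fin n))
    (hq₂ : q₂ ∈ stdSimplex ℝ (Fin n)) (ht : t ∈ Set.Icc (0 : ℝ) 1)
    (hclose : t * l1Dist q q₂ ≤ ε / 6) (hs : 10000 * (√n / ε ^ 2) < s + 1) :
    5 / 6 ≤ reshapedTestProb s q q₂ ε (mixture q q₂ t) true := by
  have : NeZero n := ⟨(pos_of_mem_stdSimplex hq).ne'⟩
  have hshift : 0 ≤ t * l1Dist q q₂ := mul_nonneg ht.1 (l1Dist_nonneg q q₂)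
  refine five_sixths_le_iidProb_identityTester_accepts hε
    (reshape_mem_stdSimplex _ (mixture_mem_stdSimplex hq hq₂ ht)) (reshape_mem_stdSimplex _ hq)
    (fun d => ?_) (fun d => ?_) ?_ (sqrt_card_buckets_div_lt hq q₂ hs)
  · have hmix := (le_abs_self _).trans (abs_reshape_mixture_sub_le ht.1 d)
    have htwo : t * l1Dist q q₂ / n ≤ 2 / n := by
      gcongr
      exact (mul_le_of_le_one_left (l1Dist_nonneg q q₂) ht.2).trans (l1Dist_le_two hq hq₂)
    calc reshape (buckets q q₂) (mixture q q₂ t) d ≤ 2 / n + 1 / n := by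
          linarith [reshape_buckets_le q q₂ d]
      _ = 3 / n := by ring
      _ ≤ 3 * 3 / Fintype.card (Σ i, Fin (buckets q q₂ i)) :=
          div_le_div_card_buckets hq q₂ (by norm_num)
      _ = _ := by norm_num
  · simpa using (reshape_buckets_le q q₂ d).trans (div_le_div_card_buckets hq q₂ zero_le_one)
  · calc l2DistSq (reshape (buckets q q₂) (mixture q q₂ t)) (reshape (buckets q q₂) q)
        ≤ t * l1Dist q q₂ / n * (t * l1Dist q q₂) := by
          simpa only [l1Dist_reshape, l1Dist_mixture_left ht.1] using
            l2DistSq_le_mul_l1Dist (abs_reshape_mixture_sub_le (q := q) (q₂ := q₂) ht.1)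
      _ = (t * l1Dist q q₂) ^ 2 / n := by ring
      _ ≤ 3 * (t * l1Dist q q₂) ^ 2 / Fintype.card (Σ i, Fin (buckets q q₂ i)) :=
          div_le_div_card_buckets hq q₂ (sq_nonneg _)
      _ ≤ 3 * (ε / 6) ^ 2 / Fintype.card (Σ i, Fin (buckets q q₂ i)) := by gcongr
      _ = ε ^ 2 / (12 * Fintype.card (Σ i, Fin (buckets q q₂ i))) := by ring

lemma five_sixths_le_reshapedTestProb_far (hε : 0 < ε) (hp : p ∈ stdSimplex ℝ (Fin n))
    (hq : q ∈ stdSimplex ℝ (Fin n)) (q₂ : Fin n → ℝ) (hfar : ε ≤ l1Dist p q)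
    (hs : 10000 * (√n / ε ^ 2) < s + 1) : 5 / 6 ≤ reshapedTestProb s q q₂ ε p false := by
  have : NeZero n := ⟨(pos_of_mem_stdSimplex hq).ne'⟩
  refine five_sixths_le_iidProb_identityTester_rejects hε (hfar.trans (l1Dist_le_two hp hq))
    (reshape_mem_stdSimplex _ hp) (reshape_mem_stdSimplex _ hq) (fun d => ?_)
    (by rwa [l1Dist_reshape]) (sqrt_card_buckets_div_lt hq q₂ hs)
  simpa using (reshape_buckets_le q q₂ d).trans (div_le_div_card_buckets hq q₂ zero_le_one)

lemma iidExp_reshape (a : Fin n → ℕ) (p : Fin n → ℝ) (F : (Fin s → Σ i, Fin (a i)) → ℝ) :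
    iidExp (reshape a p) F =
      iidExp p fun x => 𝔼 r : ∀ j, Fin (a (x j)), F fun j => ⟨x j, r j⟩ := by
  let e : (Σ x : Fin s → Fin n, ∀ j, Fin (a (x j))) ≃ (Fin s → Σ i, Fin (a i)) :=
    { toFun := fun z j => ⟨z.1 j, z.2 j⟩
      invFun := fun y => ⟨fun j => (y j).1, fun j => (y j).2⟩ }
  rw [iidExp, iidExp, ← e.sum_comp, Fintype.sum_sigma]
  refine Finset.sum_congr rfl fun x _ => ?_
  rw [Fintype.expect_eq_sum_div_card, mul_div_assoc', Finset.mul_sum, Finset.sum_div]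
  refine Finset.sum_congr rfl fun r _ => ?_
  simp only [e, Equiv.coe_fn_mk, reshape, Finset.prod_div_distrib, Fintype.card_pi,
    Fintype.card_fin, Nat.cast_prod]
  ring

end Reshape

section Learner

variable {n m : ℕ} {q₁ q₂ p : Fin n → ℝ} {ε β : ℝ}

lemma mixtureLearner_mem_Icc (q₁ q₂ : Fin n → ℝ) (ε : ℝ) (x : Fin m → Fin n) :
    mixtureLearner q₁ q₂ ε x ∈ Set.Icc (0 : ℝ) 1 := by
  rw [mixtureLearner]
  split_ifs
  · exact Set.left_mem_Icc.2 zero_le_one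
  · exact ⟨le_max_left _ _, max_le zero_le_one (min_le_left _ _)⟩

lemma mixtureLearner_close_of_lt (hε : l1Dist q₁ q₂ < ε) (hβ : β ∈ Set.Icc (0 : ℝ) 1)
    (x : Fin m → Fin n) :
    mixtureLearner q₁ q₂ ε x ≤ β ∧ (β - mixtureLearner q₁ q₂ ε x) * l1Dist q₁ q₂ ≤ ε := by
  rw [mixtureLearner, if_pos hε, sub_zero]
  exact ⟨hβ.1, (mul_le_of_le_one_left (l1Dist_nonneg q₁ q₂) hβ.2).trans hε.le⟩

lemma mixtureLearner_close (hε : 0 < ε) (h₁ : q₁ ∈ stdSimplex ℝ (Fin n))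
    (h₂ : q₂ ∈ stdSimplex ℝ (Fin n)) (hfar : ε ≤ l1Dist q₁ q₂) (hβ : β ∈ Set.Icc (0 : ℝ) 1)
    {x : Fin m → Fin n}
    (hx : |empiricalWeight (heavySet q₁ q₂) x - ∑ i ∈ heavySet q₁ q₂, mixture q₁ q₂ β i| ≤ ε / 4) :
    mixtureLearner q₁ q₂ ε x ≤ β ∧ (β - mixtureLearner q₁ q₂ ε x) * l1Dist q₁ q₂ ≤ ε := by
  have hdist := l1Dist_eq_two_mul_heavySet h₁ h₂
  simp only [mixture, Finset.sum_add_distrib, ← Finset.mul_sum] at hx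
  simp only [mixtureLearner, if_neg hfar.not_gt]
  set A := ∑ i ∈ heavySet q₁ q₂, q₁ i
  set B := ∑ i ∈ heavySet q₁ q₂, q₂ i
  set w := empiricalWeight (heavySet q₁ q₂) x
  obtain ⟨hlower, hupper⟩ := abs_le.1 hx
  have hAB : 0 < A - B := by linarith
  set c := (A - (w + ε / 4)) / (A - B) with hc
  have hc_mul : c * (A - B) = A - (w + ε / 4) := div_mul_cancel₀ _ hAB.ne'
  have hcβ : c ≤ β := by
    rw [hc, div_le_iff₀ hAB]
    linarith
  rw [min_eq_right (hcβ.trans hβ.2)]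
  refine ⟨max_le hβ.1 hcβ, ?_⟩
  calc (β - max 0 c) * l1Dist q₁ q₂ ≤ (β - c) * l1Dist q₁ q₂ :=
        mul_le_mul_of_nonneg_right (by linarith [le_max_right 0 c]) (l1Dist_nonneg q₁ q₂)
    _ = 2 * (β * (A - B) - c * (A - B)) := by rw [hdist]; ring
    _ ≤ ε := by rw [hc_mul]; linarith

lemma five_sixths_le_iidProb_empiricalWeight (hp : p ∈ stdSimplex ℝ (Fin n)) (S : Finset (Fin n))
    {t : ℝ} (ht : 0 < t) (hm : 6 ≤ m * t ^ 2) :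
    5 / 6 ≤ iidProb p {x : Fin m → Fin n | |empiricalWeight S x - ∑ i ∈ S, p i| ≤ t} := by
  have hm₀ : (0 : ℝ) < m := pos_of_mul_pos_left (by linarith) (sq_nonneg t)
  let f : Fin n → ℝ := fun i => if i ∈ S then 1 else 0
  have hmean : ∑ i, p i * f i = ∑ i ∈ S, p i := by simp [f]
  have hsum (x : Fin m → Fin n) :
      ∑ j, (f (x j) - ∑ i, p i * f i) = m * (empiricalWeight S x - ∑ i ∈ S, p i) := by
    rw [hmean, Finset.sum_sub_distrib, empiricalWeight, mul_sub, mul_div_cancel₀ _ hm₀.ne']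
    simp [f]
  have hvar : ∑ d, p d * (f d - ∑ i, p i * f i) ^ 2 ≤ 1 := by
    calc ∑ d, p d * (f d - ∑ i, p i * f i) ^ 2 ≤ ∑ d, p d * f d ^ 2 :=
          sum_mul_sub_mean_sq_le hp.2 f
      _ ≤ ∑ d, p d := Finset.sum_le_sum fun i _ => mul_le_of_le_one_right (hp.1 i) (by
          simp only [f]
          split_ifs <;> norm_num)
      _ = 1 := hp.2
  refine five_sixths_le_iidProb hp (F := fun x => ∑ j, (f (x j) - ∑ i, p i * f i))
    (mul_pos hm₀ ht) ?_ fun x hx => ?_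
  · rw [iidExp_sum_sq (l := fun d => f d - ∑ i, p i * f i) hp.2 (sum_mul_sub_mean hp.2 f)]
    nlinarith
  · rw [hsum, abs_mul, Nat.abs_cast]
    exact mul_le_mul_of_nonneg_left (not_le.1 hx).le hm₀.le

lemma five_sixths_le_iidProb_mixtureLearner (hε : 0 < ε) (h₁ : q₁ ∈ stdSimplex ℝ (Fin n))
    (h₂ : q₂ ∈ stdSimplex ℝ (Fin n)) (hβ : β ∈ Set.Icc (0 : ℝ) 1) (hm : 100 / ε ^ 2 < m + 1) :
    5 / 6 ≤ iidProb (mixture q₁ q₂ β) {x : Fin m → Fin n | mixtureLearner q₁ q₂ ε x ≤ β ∧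
      (β - mixtureLearner q₁ q₂ ε x) * l1Dist q₁ q₂ ≤ ε} := by
  have hmix := mixture_mem_stdSimplex h₁ h₂ hβ
  rcases lt_or_ge (l1Dist q₁ q₂) ε with hlt | hfar
  · refine le_of_le_of_eq (by norm_num) (iidProb_eq_one hmix.2 fun x => ?_).symm
    exact mixtureLearner_close_of_lt hlt hβ x
  · rw [div_lt_iff₀ (by positivity)] at hm
    have hε₂ : ε ≤ 2 := hfar.trans (l1Dist_le_two h₁ h₂)
    exact (five_sixths_le_iidProb_empiricalWeight hmix (heavySet q₁ q₂) (t := ε / 4)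
      (by positivity) (by nlinarith)).trans
        (iidProb_mono hmix.1 fun x hx => mixtureLearner_close hε h₁ h₂ hfar hβ hx)

end Learner

section MixtureTester

variable {n m s : ℕ} {p q₁ q₂ : Fin n → ℝ} {ε β : ℝ}

lemma toReal_map_uniformOfFintype {T B : Type*} [Fintype T] [Nonempty T]
    (f : T → B) (b : B) :
    ((PMF.uniformOfFintype T).map f b).toReal = 𝔼 r, {r | f r = b}.indicator 1 r := by
  rw [PMF.map_apply, tsum_fintype, ENNReal.toReal_sum, Fintype.expect_eq_sum_div_card,
    Finset.sum_div]
  · refine Finset.sum_congr rfl fun r _ => ?_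
    by_cases hr : f r = b
    · simp [hr]
    · simp [hr, Ne.symm hr]
  · intro r _
    split_ifs
    · exact PMF.apply_ne_top _ _
    · exact ENNReal.zero_ne_top

/-- The mixture with the parameter that the learner outputs on the samples `x`. -/
noncomputable def learnedMixture (q₁ q₂ : Fin n → ℝ) (ε : ℝ) (x : Fin m → Fin n) : Fin n → ℝ :=
  mixture q₁ q₂ (mixtureLearner q₁ q₂ ε x)

lemma learnedMixture_mem_stdSimplex (h₁ : q₁ ∈ stdSimplex ℝ (Fin n))
    (h₂ : q₂ ∈ stdSimplex ℝ (Fin n)) (ε : ℝ) (x : Fin m → Fin n) :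
    learnedMixture q₁ q₂ ε x ∈ stdSimplex ℝ (Fin n) :=
  mixture_mem_stdSimplex h₁ h₂ (mixtureLearner_mem_Icc q₁ q₂ ε x)

lemma outputProb_mixtureIdentityTester (p q₁ q₂ : Fin n → ℝ) (ε : ℝ) (m s : ℕ) (b : Bool) :
    outputProb p (mixtureIdentityTester q₁ q₂ ε m s) b =
      iidExp p fun x : Fin m → Fin n =>
        reshapedTestProb s (learnedMixture q₁ q₂ (ε / 6) x) q₂ ε p b := by
  simp only [reshapedTestProb, iidProb, iidExp_reshape]
  rw [← iidExp_castAdd_natAdd, outputProb, iidExp]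
  simp only [mixtureIdentityTester, toReal_map_uniformOfFintype]
  rfl

lemma two_thirds_le_outputProb_true (hε : 0 < ε) (h₁ : q₁ ∈ stdSimplex ℝ (Fin n))
    (h₂ : q₂ ∈ stdSimplex ℝ (Fin n)) (hβ : β ∈ Set.Icc (0 : ℝ) 1)
    (hm : 3600 / ε ^ 2 < m + 1) (hs : 10000 * (√n / ε ^ 2) < s + 1) :
    2 / 3 ≤ outputProb (mixture q₁ q₂ β) (mixtureIdentityTester q₁ q₂ ε m s) true := by
  have hmix := mixture_mem_stdSimplex h₁ h₂ hβ
  have hε₆ : 0 < ε / 6 := by positivity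
  have hlearn := five_sixths_le_iidProb_mixtureLearner (m := m) hε₆ h₁ h₂ hβ
    (by rwa [div_pow, div_div_eq_mul_div, show (100 : ℝ) * 6 ^ 2 = 3600 by norm_num])
  rw [outputProb_mixtureIdentityTester]
  refine le_trans (by norm_num : (2 / 3 : ℝ) ≤ 5 / 6 * (5 / 6)) <|
    (mul_le_mul_of_nonneg_right hlearn (by norm_num)).trans <|
      iidProb_mul_le_iidExp hmix.1 (fun x => ?_) fun x hx => ?_
  · exact iidProb_nonneg (reshape_mem_stdSimplex _ hmix).1 _
  · obtain ⟨t, ht, hmix_eq, hclose⟩ :=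
      exists_mixture_eq_mixture hε₆.le (mixtureLearner_mem_Icc q₁ q₂ (ε / 6) x) hβ.2 hx.1 hx.2
    rw [hmix_eq]
    exact five_sixths_le_reshapedTestProb_mixture hε
      (learnedMixture_mem_stdSimplex h₁ h₂ (ε / 6) x) h₂ ht hclose hs

lemma two_thirds_le_outputProb_false (hε : 0 < ε) (h₁ : q₁ ∈ stdSimplex ℝ (Fin n))
    (h₂ : q₂ ∈ stdSimplex ℝ (Fin n)) (hp : p ∈ stdSimplex ℝ (Fin n))
    (hfar : ∀ q ∈ mixtures q₁ q₂, ε ≤ l1Dist p q) (m : ℕ)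
    (hs : 10000 * (√n / ε ^ 2) < s + 1) :
    2 / 3 ≤ outputProb p (mixtureIdentityTester q₁ q₂ ε m s) false := by
  rw [outputProb_mixtureIdentityTester, ← iidExp_const (s := m) hp.2 (2 / 3)]
  refine iidExp_mono hp.1 fun x => le_trans (by norm_num) <|
    five_sixths_le_reshapedTestProb_far hε hp (learnedMixture_mem_stdSimplex h₁ h₂ (ε / 6) x) q₂
      (hfar _ ⟨_, mixtureLearner_mem_Icc q₁ q₂ (ε / 6) x, rfl⟩) hs

lemma isMixtureTester_mixtureIdentityTester (hε : 0 < ε) (h₁ : q₁ ∈ stdSimplex ℝ (Fin n))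
    (h₂ : q₂ ∈ stdSimplex ℝ (Fin n)) (hm : 3600 / ε ^ 2 < m + 1)
    (hs : 10000 * (√n / ε ^ 2) < s + 1) :
    IsMixtureTester q₁ q₂ ε (mixtureIdentityTester q₁ q₂ ε m s) := by
  refine fun p hp => ⟨?_, fun hfar => two_thirds_le_outputProb_false hε h₁ h₂ hp hfar m hs⟩
  rintro ⟨β, hβ, rfl⟩
  exact two_thirds_le_outputProb_true hε h₁ h₂ hβ hm hs

lemma cast_floor_add_floor_le (hn : 0 < n) (ε : ℝ) :
    ((⌊3600 / ε ^ 2⌋₊ + ⌊10000 * (√n / ε ^ 2)⌋₊ : ℕ) : ℝ) ≤ 13600 * (√n / ε ^ 2) := by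
  have hsqrt : 1 ≤ √(n : ℝ) := Real.one_le_sqrt.2 (by exact_mod_cast hn)
  have hinv : 1 / ε ^ 2 ≤ √n / ε ^ 2 := by gcongr
  calc ((⌊3600 / ε ^ 2⌋₊ + ⌊10000 * (√n / ε ^ 2)⌋₊ : ℕ) : ℝ)
      ≤ 3600 / ε ^ 2 + 10000 * (√n / ε ^ 2) := by
        push_cast
        gcongr <;> exact Nat.floor_le (by positivity)
    _ = 3600 * (1 / ε ^ 2) + 10000 * (√n / ε ^ 2) := by ring
    _ ≤ 13600 * (√n / ε ^ 2) := by linarith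

end MixtureTester

section SecondMoment

variable {D Z : Type*} [Fintype D] [Fintype Z] [Nonempty Z] {p : D → ℝ} {h : Z → D → ℝ} {k : ℕ}

lemma iidExp_expect_prod_sub_one_sq (hp : ∑ d, p d = 1) (hh : ∀ z, ∑ d, p d * h z d = 1) :
    iidExp p (fun y : Fin k → D => ((𝔼 z, ∏ j, h z (y j)) - 1) ^ 2) =
      (𝔼 z, 𝔼 z', (∑ d, p d * (h z d * h z' d)) ^ k) - 1 := by
  have hmean : iidExp p (fun y : Fin k → D => 𝔼 z, ∏ j, h z (y j)) = 1 := by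
    simp only [iidExp_expect, iidExp_prod, hh, one_pow, Fintype.expect_const]
  have hsq : iidExp p (fun y : Fin k → D => (𝔼 z, ∏ j, h z (y j)) ^ 2) =
      𝔼 z, 𝔼 z', (∑ d, p d * (h z d * h z' d)) ^ k := by
    simp only [sq, Finset.expect_mul_expect, iidExp_expect, ← Finset.prod_mul_distrib]
    exact Finset.expect_congr rfl fun z _ => Finset.expect_congr rfl fun z' _ =>
      iidExp_prod fun d => h z d * h z' d
  calc iidExp p (fun y : Fin k → D => ((𝔼 z, ∏ j, h z (y j)) - 1) ^ 2)
      = iidExp p fun y : Fin k → D =>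
          (𝔼 z, ∏ j, h z (y j)) ^ 2 + ((-2) * (𝔼 z, ∏ j, h z (y j)) + 1) := by
        congr 1 with y
        ring
    _ = _ := by
        rw [iidExp_add, iidExp_add, iidExp_const_mul, hmean, hsq, iidExp_const hp]
        ring

lemma sq_expect_iidExp_sub_le (hp : p ∈ stdSimplex ℝ D) (hh : ∀ z, ∑ d, p d * h z d = 1)
    {F : (Fin k → D) → ℝ} (hF : ∀ y, |F y| ≤ 1) :
    ((𝔼 z, iidExp (p * h z) F) - iidExp p F) ^ 2 ≤
      (𝔼 z, 𝔼 z', (∑ d, p d * (h z d * h z' d)) ^ k) - 1 := by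
  have hdiff : (𝔼 z, iidExp (p * h z) F) - iidExp p F =
      iidExp p fun y => ((𝔼 z, ∏ j, h z (y j)) - 1) * F y := by
    rw [sub_eq_iff_eq_add, ← iidExp_add]
    simp only [iidExp_mul, ← iidExp_expect, ← Finset.expect_mul]
    congr 1 with y
    ring
  have hsq : iidExp p (fun y => F y ^ 2) ≤ 1 :=
    (iidExp_mono hp.1 fun y => (sq_le_one_iff_abs_le_one _).2 (hF y)).trans_eq
      (iidExp_const hp.2 1)
  have hvar : 0 ≤ iidExp p fun y : Fin k → D => ((𝔼 z, ∏ j, h z (y j)) - 1) ^ 2 :=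
    (iidExp_const hp.2 0).symm.trans_le (iidExp_mono hp.1 fun y => sq_nonneg _)
  rw [hdiff, ← iidExp_expect_prod_sub_one_sq hp.2 hh]
  exact (sq_iidExp_mul_le hp.1 _ _).trans (mul_le_of_le_one_right hvar hsq)

end SecondMoment

section TesterSecondMoment

variable {n k : ℕ} {q : Fin n → ℝ} {ε : ℝ}

lemma toReal_true_add_toReal_false (P : PMF Bool) : (P true).toReal + (P false).toReal = 1 := by
  rw [← ENNReal.toReal_add (P.apply_ne_top _) (P.apply_ne_top _), ← Fintype.sum_bool,
    ← tsum_fintype (L := .unconditional _), P.tsum_coe, ENNReal.toReal_one]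

lemma outputProb_true_add_outputProb_false (hq : ∑ i, q i = 1) (A : SampleAlgorithm n k) :
    outputProb q A true + outputProb q A false = 1 := by
  calc outputProb q A true + outputProb q A false
      = iidExp q fun x => (A x true).toReal + (A x false).toReal := (iidExp_add _ _).symm
    _ = 1 := by simp only [toReal_true_add_toReal_false, iidExp_const hq]

lemma mixtures_self (q : Fin n → ℝ) : mixtures q q = {q} := by
  have hmix (α : ℝ) : mixture q q α = q := by
    ext i
    rw [mixture]
    ring
  ext p
  simp only [mixtures, hmix, Set.mem_ofPred_eq, Set.mem_singleton_iff]
  exact ⟨fun ⟨_, _, hp⟩ => hp, fun hp => ⟨0, Set.left_mem_Icc.2 zero_le_one, hp⟩⟩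

lemma IsMixtureTester.ten_ninths_le_expect {Z : Type*} [Fintype Z] [Nonempty Z]
    {A : SampleAlgorithm n k} (hA : IsMixtureTester q q ε A) (hq : q ∈ stdSimplex ℝ (Fin n))
    {h : Z → Fin n → ℝ} (hh : ∀ z, q * h z ∈ stdSimplex ℝ (Fin n))
    (hfar : ∀ z, ε ≤ l1Dist (q * h z) q) :
    10 / 9 ≤ 𝔼 z, 𝔼 z', (∑ i, q i * (h z i * h z' i)) ^ k := by
  have haccept : 2 / 3 ≤ outputProb q A true := (hA q hq).1 (by simp [mixtures_self])
  have hreject (z : Z) : 2 / 3 ≤ outputProb (q * h z) A false :=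
    (hA _ (hh z)).2 (by simpa [mixtures_self] using hfar z)
  have hsum := outputProb_true_add_outputProb_false hq.2 A
  have hmean : 2 / 3 ≤ 𝔼 z, outputProb (q * h z) A false :=
    Finset.le_expect Finset.univ_nonempty fun z _ => hreject z
  have hsq : ((𝔼 z, outputProb (q * h z) A false) - outputProb q A false) ^ 2 ≤
      (𝔼 z, 𝔼 z', (∑ i, q i * (h z i * h z' i)) ^ k) - 1 :=
    sq_expect_iidExp_sub_le hq (fun z => (hh z).2) fun x => by
      rw [abs_of_nonneg ENNReal.toReal_nonneg]
      exact ENNReal.toReal_mono ENNReal.one_ne_top (PMF.coe_le_one _ _)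
  nlinarith

end TesterSecondMoment

section UniformPerturbation

variable {n k : ℕ} {φ ψ : Fin n → ℝ} {ε : ℝ}

lemma uniform_nonneg (n : ℕ) (i : Fin n) : 0 ≤ uniform n i := by
  rw [uniform]
  positivity

lemma sum_uniform (hn : 0 < n) : ∑ i, uniform n i = 1 := by
  simp [uniform, hn.ne']

lemma sum_uniform_mul_one_add_mul_one_add (hn : 0 < n) (hφ : ∑ i, φ i = 0) (hψ : ∑ i, ψ i = 0) :
    ∑ i, uniform n i * ((1 + φ) i * (1 + ψ) i) = 1 + (∑ i, φ i * ψ i) / n := by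
  calc ∑ i, uniform n i * ((1 + φ) i * (1 + ψ) i)
      = ∑ i, uniform n i + (∑ i, φ i + ∑ i, ψ i + ∑ i, φ i * ψ i) / n := by
        simp only [← Finset.sum_add_distrib, Finset.sum_div]
        refine Finset.sum_congr rfl fun i _ => ?_
        simp only [uniform, Pi.add_apply, Pi.one_apply]
        ring
    _ = _ := by rw [sum_uniform hn, hφ, hψ, zero_add, zero_add]

lemma uniform_mul_one_add_mem_stdSimplex (hn : 0 < n) (hφ : ∑ i, φ i = 0) (hφ₁ : ∀ i, -1 ≤ φ i) :
    uniform n * (1 + φ) ∈ stdSimplex ℝ (Fin n) := by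
  refine ⟨fun i => mul_nonneg (uniform_nonneg n i) (neg_le_iff_add_nonneg'.1 (hφ₁ i)), ?_⟩
  simpa using sum_uniform_mul_one_add_mul_one_add hn hφ (ψ := 0) (by simp)

lemma l1Dist_uniform_mul_one_add (φ : Fin n → ℝ) :
    l1Dist (uniform n * (1 + φ)) (uniform n) = (∑ i, |φ i|) / n := by
  rw [l1Dist, Finset.sum_div]
  refine Finset.sum_congr rfl fun i _ => ?_
  rw [Pi.mul_apply, Pi.add_apply, Pi.one_apply, mul_one_add, add_sub_cancel_left, uniform,
    one_div_mul_eq_div, abs_div, Nat.abs_cast]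

lemma IsMixtureTester.ten_ninths_le_expect_exp {Z : Type*} [Fintype Z] [Nonempty Z]
    {A : SampleAlgorithm n k} (hA : IsMixtureTester (uniform n) (uniform n) ε A) (hn : 0 < n)
    {φ : Z → Fin n → ℝ} (hφ : ∀ z, ∑ i, φ z i = 0) (hφ₁ : ∀ z i, -1 ≤ φ z i)
    (hfar : ∀ z, ε * n ≤ ∑ i, |φ z i|) :
    10 / 9 ≤ 𝔼 z, 𝔼 z', Real.exp (k * ((∑ i, φ z i * φ z' i) / n)) := by
  have hmem (z : Z) := uniform_mul_one_add_mem_stdSimplex hn (hφ z) (hφ₁ z)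
  have hfar' (z : Z) : ε ≤ l1Dist (uniform n * (1 + φ z)) (uniform n) := by
    rw [l1Dist_uniform_mul_one_add, le_div_iff₀ (by exact_mod_cast hn)]
    exact hfar z
  refine (hA.ten_ninths_le_expect ⟨uniform_nonneg n, sum_uniform hn⟩ hmem hfar').trans <|
    Finset.expect_le_expect fun z _ => Finset.expect_le_expect fun z' _ => ?_
  rw [Real.exp_nat_mul]
  refine pow_le_pow_left₀ (Finset.sum_nonneg fun i _ => ?_) ?_ k
  · exact mul_nonneg (uniform_nonneg n i) (mul_nonneg (neg_le_iff_add_nonneg'.1 (hφ₁ z i))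
      (neg_le_iff_add_nonneg'.1 (hφ₁ z' i)))
  · rw [sum_uniform_mul_one_add_mul_one_add hn (hφ z) (hφ z'), add_comm]
    exact Real.add_one_le_exp _

end UniformPerturbation

section PairPerturbation

/-- The sign attached to a bit, used to index the perturbations of the uniform distribution by bit
vectors. -/
def bitSign (b : Bool) : ℝ := if b then 1 else -1

lemma abs_bitSign (b : Bool) : |bitSign b| = 1 := by cases b <;> simp [bitSign]

lemma expect_exp_bitSign {P : Type*} [Fintype P] [DecidableEq P] (t : ℝ) (z : P → Bool) :
    𝔼 z' : P → Bool, Real.exp (t * ∑ l, bitSign (z l) * bitSign (z' l)) =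
      Real.cosh t ^ Fintype.card P := by
  have hbit (a : Bool) : ∑ b, Real.exp (t * (bitSign a * bitSign b)) = 2 * Real.cosh t := by
    rw [Real.cosh_eq, Fintype.sum_bool]
    cases a <;> simp [bitSign] <;> ring
  have hsum : ∑ z' : P → Bool, Real.exp (t * ∑ l, bitSign (z l) * bitSign (z' l)) =
      (2 * Real.cosh t) ^ Fintype.card P := by
    simp only [Finset.mul_sum, Real.exp_sum]
    rw [← Fintype.prod_sum fun l b => Real.exp (t * (bitSign (z l) * bitSign b))]
    simp only [hbit, Finset.prod_const, Finset.card_univ]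
  rw [Fintype.expect_eq_sum_div_card, hsum, mul_pow]
  simp

variable {D O P : Type*}

/-- The perturbation that is the fixed vector `w` on the exceptional elements `O` and, on the pair
with index `l`, takes the values `1` and `-1` in the order given by the bit `z l`. -/
def pairPerturbation (e : D ≃ O ⊕ P × Bool) (w : O → ℝ) (z : P → Bool) (d : D) : ℝ :=
  Sum.elim w (fun x => bitSign (z x.1) * bitSign x.2) (e d)

variable (e : D ≃ O ⊕ P × Bool) {w : O → ℝ} (z z' : P → Bool)

lemma neg_one_le_pairPerturbation (hw : ∀ j, -1 ≤ w j) (d : D) :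
    -1 ≤ pairPerturbation e w z d := by
  rw [pairPerturbation]
  rcases e d with j | ⟨l, b⟩
  · exact hw j
  · exact (abs_le.1 (by simp [abs_mul, abs_bitSign])).1

variable [Fintype D] [Fintype O]

lemma sum_comp_pairPerturbation [Fintype P] (F : ℝ → ℝ → ℝ) :
    ∑ d, F (pairPerturbation e w z d) (pairPerturbation e w z' d) = ∑ j, F (w j) (w j) +
      ∑ l, (F (bitSign (z l)) (bitSign (z' l)) + F (-bitSign (z l)) (-bitSign (z' l))) := by
  simp only [pairPerturbation]
  rw [e.sum_comp fun a => F (Sum.elim w (fun x => bitSign (z x.1) * bitSign x.2) a)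
    (Sum.elim w (fun x => bitSign (z' x.1) * bitSign x.2) a)]
  simp [Fintype.sum_prod_type, bitSign]

lemma sum_pairPerturbation [Finite P] (hw : ∑ j, w j = 0) :
    ∑ d, pairPerturbation e w z d = 0 := by
  have := Fintype.ofFinite P
  simpa [hw] using sum_comp_pairPerturbation e (w := w) z z fun a _ => a

lemma sum_pairPerturbation_mul [Fintype P] :
    ∑ d, pairPerturbation e w z d * pairPerturbation e w z' d =
      ∑ j, w j ^ 2 + 2 * ∑ l, bitSign (z l) * bitSign (z' l) := by
  rw [sum_comp_pairPerturbation e z z' fun a b => a * b, Finset.mul_sum]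
  simp only [sq, neg_mul_neg, two_mul]

lemma sum_abs_pairPerturbation [Fintype P] :
    ∑ d, |pairPerturbation e w z d| = ∑ j, |w j| + 2 * Fintype.card P := by
  rw [sum_comp_pairPerturbation e z z fun a _ => |a|]
  simp only [abs_neg, abs_bitSign, Finset.sum_const, Finset.card_univ, nsmul_eq_mul]
  ring

-- For odd `n` the exceptional elements are a triple, perturbed by `(2, -1, -1)`.
lemma exists_pairing {n : ℕ} (hn : 2 ≤ n) :
    ∃ (o N : ℕ) (_ : Fin n ≃ Fin o ⊕ Fin N × Bool) (w : Fin o → ℝ),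
      ∑ j, w j = 0 ∧ (o : ℝ) ≤ ∑ j, |w j| ∧ (∀ j, -1 ≤ w j) ∧ ∑ j, w j ^ 2 ≤ 6 := by
  obtain ⟨N, rfl | rfl⟩ := Nat.even_or_odd' n
  · exact ⟨0, N, Fintype.equivOfCardEq (by simp [mul_comm]), 0, by simp⟩
  · obtain ⟨K, rfl⟩ : ∃ K, N = K + 1 := ⟨N - 1, by omega⟩
    refine ⟨3, K, Fintype.equivOfCardEq (by simp; ring), ![2, -1, -1], ?_, ?_, ?_, ?_⟩
    · norm_num [Fin.sum_univ_succ]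
    · norm_num [Fin.sum_univ_succ]
    · intro j
      fin_cases j <;> norm_num
    · norm_num [Fin.sum_univ_succ]

lemma exists_signed_perturbations {n : ℕ} (hn : 2 ≤ n) :
    ∃ (N : ℕ) (φ : (Fin N → Bool) → Fin n → ℝ), 2 * N ≤ n ∧ (∀ z, ∑ i, φ z i = 0) ∧
      (∀ z i, -1 ≤ φ z i) ∧ (∀ z, (n : ℝ) ≤ ∑ i, |φ z i|) ∧
      ∀ z z', ∑ i, φ z i * φ z' i ≤ 6 + 2 * ∑ l, bitSign (z l) * bitSign (z' l) := by
  obtain ⟨o, N, e, w, hsum, habs, hneg, hsq⟩ := exists_pairing hn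
  have hcard : n = o + 2 * N := by simpa [mul_comm] using Fintype.card_congr e
  refine ⟨N, pairPerturbation e w, by omega, fun z => sum_pairPerturbation e z hsum,
    fun z => neg_one_le_pairPerturbation e z hneg, fun z => ?_, fun z z' => ?_⟩
  · rw [sum_abs_pairPerturbation, Fintype.card_fin, hcard]
    push_cast
    gcongr
  · rw [sum_pairPerturbation_mul]
    gcongr

end PairPerturbation

section SampleLowerBound

variable {n k : ℕ} {ε : ℝ}

lemma expect_expect_exp_bitSign_le {N : ℕ} (hN : 2 * N ≤ n) (t : ℝ) :
    𝔼 z : Fin N → Bool, 𝔼 z' : Fin N → Bool,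
      Real.exp (t * (6 + 2 * ∑ l, bitSign (z l) * bitSign (z' l))) ≤
        Real.exp (6 * t + n * t ^ 2) := by
  simp only [mul_add, Real.exp_add, ← mul_assoc t 2, ← Finset.mul_expect, expect_exp_bitSign,
    Fintype.expect_const, Fintype.card_fin, mul_comm t 6]
  gcongr
  calc Real.cosh (t * 2) ^ N ≤ Real.exp ((t * 2) ^ 2 / 2) ^ N :=
        pow_le_pow_left₀ (Real.cosh_pos _).le (Real.cosh_le_exp_half_sq _) N
    _ = Real.exp ((2 * N : ℕ) * t ^ 2) := by
        rw [← Real.exp_nat_mul]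
        push_cast
        ring_nf
    _ ≤ Real.exp (n * t ^ 2) := by gcongr

lemma IsMixtureTester.ten_ninths_le_exp {A : SampleAlgorithm n k}
    (hA : IsMixtureTester (uniform n) (uniform n) ε A) (hn : 2 ≤ n) (hε : 0 ≤ ε) (hε₁ : ε ≤ 1) :
    10 / 9 ≤ Real.exp (6 * (k * ε ^ 2 / n) + n * (k * ε ^ 2 / n) ^ 2) := by
  obtain ⟨N, φ, hN, hsum, hneg, habs, hmul⟩ := exists_signed_perturbations hn
  refine (hA.ten_ninths_le_expect_exp (by omega) (φ := fun z i => ε * φ z i) (fun z => ?_)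
    (fun z i => ?_) fun z => ?_).trans <| le_trans ?_ (expect_expect_exp_bitSign_le hN _)
  · rw [← Finset.mul_sum, hsum, mul_zero]
  · nlinarith [hneg z i]
  · simp only [abs_mul, abs_of_nonneg hε, ← Finset.mul_sum]
    exact mul_le_mul_of_nonneg_left (habs z) hε
  · refine Finset.expect_le_expect fun z _ => Finset.expect_le_expect fun z' _ =>
      Real.exp_le_exp.2 ?_
    calc k * ((∑ i, ε * φ z i * (ε * φ z' i)) / n) = k * ε ^ 2 / n * ∑ i, φ z i * φ z' i := by
          simp only [mul_mul_mul_comm, ← Finset.mul_sum]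
          ring
      _ ≤ _ := mul_le_mul_of_nonneg_left (hmul z z') (by positivity)

lemma IsMixtureTester.sqrt_div_sq_le {A : SampleAlgorithm n k}
    (hA : IsMixtureTester (uniform n) (uniform n) ε A) (hn : 2 ≤ n) (hε : 0 < ε) (hε₁ : ε ≤ 1) :
    1 / 100 * (√n / ε ^ 2) ≤ k := by
  by_contra! hlt
  have hsqrt : 1 ≤ √(n : ℝ) := Real.one_le_sqrt.2 (by exact_mod_cast (by omega : 1 ≤ n))
  set t : ℝ := k * ε ^ 2 / n with ht
  have ht₀ : 0 ≤ t := by positivity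
  have hsmall : √n * t ≤ 1 / 100 := by
    rw [← mul_div_assoc, lt_div_iff₀ (by positivity)] at hlt
    rw [ht, mul_div_assoc', div_le_iff₀ (by positivity)]
    nlinarith [Real.sq_sqrt n.cast_nonneg]
  have hlinear : t ≤ 1 / 100 := (le_mul_of_one_le_left ht₀ hsqrt).trans hsmall
  have hquadratic : n * t ^ 2 ≤ 1 / 10000 := by
    calc n * t ^ 2 = (√n * t) ^ 2 := by rw [mul_pow, Real.sq_sqrt n.cast_nonneg]
      _ ≤ (1 / 100) ^ 2 := by gcongr
      _ = 1 / 10000 := by norm_num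
  have hexp : Real.exp (6 * t + n * t ^ 2) ≤ Real.exp (7 / 100) := Real.exp_le_exp.2 (by linarith)
  have hbound : Real.exp (7 / 100) < 10 / 9 :=
    (Real.exp_bound_div_one_sub_of_interval' (by norm_num) (by norm_num)).trans (by norm_num)
  linarith [hA.ten_ninths_le_exp hn hε.le hε₁]

end SampleLowerBound

end MixtureTesting

theorem theorem1 :
    (∃ C₁ C₂ C : ℝ, 0 < C₁ ∧ 0 < C₂ ∧ 0 < C ∧
      ∀ (n : ℕ) (ε : ℝ), 0 < ε →
        ∀ q₁ ∈ stdSimplex ℝ (Fin n), ∀ q₂ ∈ stdSimplex ℝ (Fin n),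
          ∃ m s : ℕ, m = ⌊C₁ / ε ^ 2⌋₊ ∧ s = ⌊C₂ * (√(n : ℝ) / ε ^ 2)⌋₊ ∧
            ((m + s : ℕ) : ℝ) ≤ C * (√(n : ℝ) / ε ^ 2) ∧
            MixtureTesting.IsMixtureTester q₁ q₂ ε
              (MixtureTesting.mixtureIdentityTester q₁ q₂ ε m s)) ∧
    (∃ c : ℝ, 0 < c ∧
      ∀ (n : ℕ) (ε : ℝ), 2 ≤ n → 0 < ε → ε ≤ 1 →
        ∀ (k : ℕ) (A : MixtureTesting.SampleAlgorithm n k),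
          MixtureTesting.IsMixtureTester
            (MixtureTesting.uniform n) (MixtureTesting.uniform n) ε A →
          c * (√(n : ℝ) / ε ^ 2) ≤ (k : ℝ)) := by
  refine ⟨⟨3600, 10000, 13600, by norm_num, by norm_num, by norm_num,
    fun n ε hε q₁ h₁ q₂ h₂ => ⟨_, _, rfl, rfl, ?_, ?_⟩⟩, 1 / 100, by norm_num,
    fun n ε hn hε hε₁ k A hA => hA.sqrt_div_sq_le hn hε hε₁⟩
  · exact MixtureTesting.cast_floor_add_floor_le (MixtureTesting.pos_of_mem_stdSimplex h₁) ε
  · exact MixtureTesting.isMixtureTester_mixtureIdentityTester hε h₁ h₂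
      (Nat.lt_floor_add_one _) (Nat.lt_floor_add_one _)
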